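/- Let $(M,g)$ be a smooth Riemannian manifold of dimension $m\ge 1$ with (possibly empty) boundary $\partial M$, with Levi-Civita connection $\nabla$, curvature $R(u,v)w=\nabla_u\nabla_vw-\nabla_v\nabla_uw-\nabla_{[u,v]}w$, Ricci tensor $\mathrm{Ric}(v,w)=\mathrm{tr}(u\mapsto R(u,v)w)$ and curvature operator given by $\langle \mathfrak R(u\wedge v),u'\wedge v'\rangle=g(R(u,v)v',u')$ on $\Lambda^2TM$. Let $\Delta=d\delta+\delta d$ be the Hodge Laplacian and $\nabla^*\nabla=-\mathrm{tr}\,\nabla^2$ the connection Laplacian on $p$-forms. The Weitzenböck tensor $\mathcal R^W_p$ is the endomorphism of $\Lambda^pT^*M$ with $\Delta=\nabla^*\nabla-\mathcal R^W_p$ on smooth $p$-forms. At $x\in\partial M$ let $\nu$ be the inward unit normal, let $l(v,w)=g(\nabla_vw,\nu)$ be the second fundamental form on $T_x\partial M$ with respect to $\nu$ (so $l\ge 0$ for the Euclidean ball), and denote by $l|_x$ also the corresponding symmetric operator on $T_x\partial M$. The boundary tensor $\mathcal S_p|_x$ is the symmetric endomorphism of $\Lambda^pT_x^*M$ that vanishes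 on all $\omega$ with $i_\nu\omega=0$ and satisfies $$(\mathcal S_p\omega,\omega)=(\omega,i_\nu d\omega)-(\delta\omega,i_\nu\omega)-\tfrac12\,\frac{\partial}{\partial\nu}(\omega,\omega)\quad\text{at }x$$ for every smooth $p$-form $\omega$ near $x$ whose restriction (pull-back) to $\partial M$ is zero; for $p=0$ the term with $\delta\omega$ is zero. Then $\mathcal R^W_p$ and $\mathcal S_p$ exist and are unique for every $p\ge 0$, and the following hold. 1. $\mathcal R^W_1=-\mathrm{Ric}$, where $\mathrm{Ric}$ acts on $1$-forms as the Ricci operator. If the curvature operator is $\ge 0$ at a point $x$ of $M$, then $\mathcal R^W_p\le 0$ at $x$ for all $p$. 2. Let $x\in\partial M$ and $1\le p\le m$. If the sum of the $m-p$ smallest eigenvalues of $l|_x$ (counted with multiplicity) is non-negative, then $\mathcal S_p|_x\le 0$. In particular, if $\mathrm{tr}\,l|_x\ge 0$, then $\mathcal S_1|_x\le 0$; and if $l|_x\ge 0$, then $\mathcal S_p|_x\le 0$ for all $p\ge 0$. -/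

import Mathlib

open scoped Manifold ContDiff Topology
open Set

noncomputable section

namespace BoundaryGeometry

/-! ### Linear algebra of a scalar product on `ℝᵐ` -/

/-- The model vector space `ℝᵐ`; Mathlib's `TangentSpace (𝓡∂ m) x` is this space, identified with
the tangent space at `x` by the preferred chart at `x`. -/
abbrev Model (m : ℕ) : Type := EuclideanSpace ℝ (Fin m)

/-- The space of (exterior) `p`-forms on `ℝᵐ`. -/
abbrev Form (m p : ℕ) : Type := Model m [⋀^Fin p]→L[ℝ] ℝ

/-- The standard basis of `ℝᵐ`. -/
def stdVec {m : ℕ} (i : Fin m) : Model m := EuclideanSpace.single i (1 : ℝ)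

/-- The coefficients `g^{ij}` of the inverse of the Gram matrix `g_{ij} = b(e_i, e_j)`. -/
def invGram {m : ℕ} (b : Model m →L[ℝ] Model m →L[ℝ] ℝ) (i j : Fin m) : ℝ :=
  (Matrix.of fun k l : Fin m => b (stdVec k) (stdVec l))⁻¹ i j

/-- The scalar product induced by `b` on `p`-forms,
`(α, β) = 1/p! ∑ g^{i₁j₁} ⋯ g^{i_pj_p} α_{i₁…i_p} β_{j₁…j_p}`.  If `e^1, …, e^m` is dual to a
`b`-orthonormal basis, then the forms `e^{i₁} ∧ ⋯ ∧ e^{i_p}`, `i₁ < ⋯ < i_p`, are orthonormal. -/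
def formInner {m p : ℕ} (b : Model m →L[ℝ] Model m →L[ℝ] ℝ) (α β : Form m p) : ℝ :=
  ((p.factorial : ℝ))⁻¹ * ∑ I : Fin p → Fin m, ∑ J : Fin p → Fin m,
    (∏ k, invGram b (I k) (J k)) * α (fun k => stdVec (I k)) * β (fun k => stdVec (J k))

/-- The derivation of the exterior algebra extending the action of the endomorphism `A`:
`(A · α)(v₁, …, v_p) = ∑ₖ α(v₁, …, A vₖ, …, v_p)`. -/
def formAction {m p : ℕ} (A : Model m →L[ℝ] Model m) (α : Form m p) : Form m p :=
  α.fderivCompContinuousLinearMap (ContinuousLinearMap.id ℝ (Model m)) A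

theorem formAction_apply {m p : ℕ} (A : Model m →L[ℝ] Model m) (α : Form m p)
    (v : Fin p → Model m) :
    formAction A α v = ∑ k, α (Function.update v k (A (v k))) := by
  simp only [formAction, ContinuousAlternatingMap.fderivCompContinuousLinearMap_apply]
  refine Finset.sum_congr rfl fun k _ => congrArg α (funext fun j => ?_)
  rcases eq_or_ne j k with rfl | h
  · simp
  · simp [h]

/-! ### Riemannian geometry in a chart of the half space

`G` is the coordinate expression of a Riemannian metric, vector fields are functions
`Model m → Model m`, and `p`-forms are functions `Model m → Form m p`.  All derivatives are taken
within the half space `{y | 0 ≤ y 0}`, hence are one-sided at its boundary. -/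

/-- The closed half space `{y ∈ ℝᵐ | 0 ≤ y 0}`. -/
abbrev halfSpace (m : ℕ) [NeZero m] : Set (Model m) := range (𝓡∂ m)

section Chart

variable {m : ℕ} [NeZero m] (G : Model m → Model m →L[ℝ] Model m →L[ℝ] ℝ)

/-- The Christoffel symbols, `Γ(v, w) = ∑ g^{kl} ½ (∂_v g(w, e_l) + ∂_w g(v, e_l) - ∂_l g(v, w)) e_k`,
as a linear map in `w`. -/
def christoffel (y v : Model m) : Model m →L[ℝ] Model m :=
  ∑ k, ∑ l, ((1 / 2 : ℝ) * invGram (G y) k l) •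
    ((fderivWithin ℝ G (halfSpace m) y v).flip (stdVec l)
      + ((fderivWithin ℝ G (halfSpace m) y).flip v).flip (stdVec l)
      - fderivWithin ℝ G (halfSpace m) y (stdVec l) v).smulRight (stdVec k)

/-- The Levi-Civita derivative `∇_v X` of the vector field `X` at `y`. -/
def covVec (X : Model m → Model m) (y v : Model m) : Model m :=
  fderivWithin ℝ X (halfSpace m) y v + christoffel G y v (X y)

/-- The curvature `R(u, v) w = ∇_u ∇_v w - ∇_v ∇_u w` at `y`; here `u`, `v`, `w` are extended to
vector fields with constant coefficients, so that `[u, v] = 0`. -/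
def riemann (y u v w : Model m) : Model m :=
  covVec G (fun z => covVec G (fun _ => w) z v) y u
    - covVec G (fun z => covVec G (fun _ => w) z u) y v

/-- The Levi-Civita derivative `∇_v α` of the `p`-form `α` at `y`. -/
def covForm {p : ℕ} (α : Model m → Form m p) (y v : Model m) : Form m p :=
  fderivWithin ℝ α (halfSpace m) y v - formAction (christoffel G y v) (α y)

/-- The second covariant derivative `∇²_{u,v} α = ∇_u (∇_v α) - ∇_{∇_u v} α` at `y`. -/
def covForm₂ {p : ℕ} (α : Model m → Form m p) (y u v : Model m) : Form m p :=
  covForm G (fun z => covForm G α z v) y u - covForm G α y (christoffel G y u v)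

/-- The connection Laplacian `∇^*∇ α = - ∑ g^{ij} ∇²_{e_i,e_j} α`. -/
def connLaplacian {p : ℕ} (α : Model m → Form m p) (y : Model m) : Form m p :=
  - ∑ i, ∑ j, invGram (G y) i j • covForm₂ G α y (stdVec i) (stdVec j)

/-- The codifferential `δ α = - ∑ g^{ij} i_{e_j} ∇_{e_i} α` of a form of positive degree. -/
def codiff {p : ℕ} (α : Model m → Form m (p + 1)) (y : Model m) : Form m p :=
  - ∑ i, ∑ j, invGram (G y) i j • (covForm G α y (stdVec i)).curryLeft (stdVec j)

/-- The Hodge Laplacian `Δ = d δ + δ d`, with `δ = 0` on functions. -/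
def hodgeLaplacian : {p : ℕ} → (Model m → Form m p) → Model m → Form m p
  | 0, α, y => codiff G (extDerivWithin α (halfSpace m)) y
  | _ + 1, α, y => extDerivWithin (codiff G α) (halfSpace m) y
      + codiff G (extDerivWithin α (halfSpace m)) y

/-- The inward unit normal of the hypersurfaces `{y 0 = const}`: the gradient of the coordinate
function `y 0`, divided by its length. -/
def unitNormal (y : Model m) : Model m :=
  (Real.sqrt (invGram (G y) 0 0))⁻¹ • ∑ k, invGram (G y) k 0 • stdVec k

/-- `(δ α, i_ν α)` at `y`, which is zero on functions. -/
def codiffTerm : {p : ℕ} → (Model m → Form m p) → Model m → ℝ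
  | 0, _, _ => 0
  | _ + 1, α, y => formInner (G y) (codiff G α y) ((α y).curryLeft (unitNormal G y))

/-- `(α, i_ν dα) - (δ α, i_ν α) - ½ ∂_ν (α, α)` at `y`. -/
def boundaryExpr {p : ℕ} (α : Model m → Form m p) (y : Model m) : ℝ :=
  formInner (G y) (α y) ((extDerivWithin α (halfSpace m) y).curryLeft (unitNormal G y))
    - codiffTerm G α y
    - 1 / 2 * fderivWithin ℝ (fun z => formInner (G z) (α z) (α z)) (halfSpace m) y
        (unitNormal G y)

theorem christoffel_add_left (y v v' w : Model m) :
    christoffel G y (v + v') w = christoffel G y v w + christoffel G y v' w := by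
  simp only [christoffel, ← Finset.sum_add_distrib, FunLike.coe_sum, Finset.sum_apply,
    FunLike.coe_smul, Pi.smul_apply]
  refine Finset.sum_congr rfl fun k _ => Finset.sum_congr rfl fun l _ => ?_
  simp only [ContinuousLinearMap.smulRight_apply, ContinuousLinearMap.flip_apply, map_add,
    add_apply, sub_apply, smul_smul, ← add_smul]
  congr 1
  ring

theorem christoffel_smul_left (y : Model m) (c : ℝ) (v w : Model m) :
    christoffel G y (c • v) w = c • christoffel G y v w := by
  simp only [christoffel, Finset.smul_sum, FunLike.coe_sum, Finset.sum_apply,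
    FunLike.coe_smul, Pi.smul_apply]
  refine Finset.sum_congr rfl fun k _ => Finset.sum_congr rfl fun l _ => ?_
  simp only [ContinuousLinearMap.smulRight_apply, ContinuousLinearMap.flip_apply, map_smul,
    add_apply, sub_apply, FunLike.coe_smul, Pi.smul_apply,
    smul_smul, smul_eq_mul]
  congr 1
  ring

/-- The second fundamental form `l(v, w) = g(∇_v w, ν)` of the hypersurfaces `{y 0 = const}`; the
vector `w`, with `w 0 = 0`, is extended to the tangential field with constant coefficients. -/
def secondForm (y : Model m) : LinearMap.BilinForm ℝ (Model m) :=
  LinearMap.mk₂ ℝ (fun v w => G y (covVec G (fun _ => w) y v) (unitNormal G y))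
    (fun v v' w => by simp [covVec, christoffel_add_left])
    (fun c v w => by simp [covVec, christoffel_smul_left])
    (fun v w w' => by simp [covVec])
    (fun c v w => by simp [covVec])

end Chart

/-! ### Riemannian manifolds with boundary -/

section Manifold

variable {m : ℕ} [NeZero m] {M : Type*} [TopologicalSpace M]
  [ChartedSpace (EuclideanHalfSpace m) M]

/-- A Riemannian metric of class `C^∞` on the manifold with boundary `M`. -/
abbrev Metric (m : ℕ) [NeZero m] (M : Type*) [TopologicalSpace M]
    [ChartedSpace (EuclideanHalfSpace m) M] [IsManifold (𝓡∂ m) ∞ M] : Type _ :=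
  Bundle.ContMDiffRiemannianMetric (𝓡∂ m) ∞ (Model m) (fun x : M => TangentSpace (𝓡∂ m) x)

/-- The exterior forms of degree `p` on the tangent space at `x`, that is `Λ^p T_x^* M`. -/
abbrev FormAt (m : ℕ) [NeZero m] {M : Type*} [TopologicalSpace M]
    [ChartedSpace (EuclideanHalfSpace m) M] (p : ℕ) (x : M) : Type :=
  TangentSpace (𝓡∂ m) x [⋀^Fin p]→L[ℝ] ℝ

/-- The coordinates of `x` in the preferred chart at `x`. -/
def pt (m : ℕ) [NeZero m] {M : Type*} [TopologicalSpace M]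
    [ChartedSpace (EuclideanHalfSpace m) M] (x : M) : Model m := extChartAt (𝓡∂ m) x x

/-- The differential of the inverse of the preferred chart at `x`, at the coordinates `y`. -/
def chartInvDeriv (x : M) (y : Model m) :
    Model m →L[ℝ] TangentSpace (𝓡∂ m) ((extChartAt (𝓡∂ m) x).symm y) :=
  mfderivWithin 𝓘(ℝ, Model m) (𝓡∂ m) (extChartAt (𝓡∂ m) x).symm (halfSpace m) y

/-- The coordinate expression of a differential form in the preferred chart at `x`: its pull-back
under the inverse of the chart. -/
def localForm {p : ℕ} (x : M) (α : ∀ z : M, FormAt m p z) (y : Model m) : Form m p :=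
  (α ((extChartAt (𝓡∂ m) x).symm y)).compContinuousLinearMap (chartInvDeriv x y)

/-- The form `α` is of class `C^∞` on a neighbourhood of `x`. -/
def SmoothNear {p : ℕ} (x : M) (α : ∀ z : M, FormAt m p z) : Prop :=
  ∃ U ∈ 𝓝 (pt m x), ContDiffOn ℝ ∞ (localForm x α) (U ∩ halfSpace m)

/-- The restriction (pull-back) of `α` to the boundary vanishes on a neighbourhood of `x`. In a
chart the boundary is `{y 0 = 0}` and its tangent vectors are those with `v 0 = 0`. -/
def RestrictsToZeroNear {p : ℕ} (x : M) (α : ∀ z : M, FormAt m p z) : Prop :=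
  ∀ᶠ y in 𝓝 (pt m x), y 0 = 0 →
    ∀ v : Fin p → Model m, (∀ k, v k 0 = 0) → localForm x α y v = 0

/-- The vectors `v ∈ T_x M` with `v 0 = 0`; for a boundary point `x` this is `T_x ∂M`. -/
def bdryTangent (m : ℕ) [NeZero m] {M : Type*} [TopologicalSpace M]
    [ChartedSpace (EuclideanHalfSpace m) M] (x : M) : Submodule ℝ (TangentSpace (𝓡∂ m) x) where
  carrier := {v | (show Model m from v) 0 = 0}
  add_mem' {v w} hv hw := by
    change (show Model m from v) 0 + (show Model m from w) 0 = 0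
    rw [show (show Model m from v) 0 = 0 from hv, show (show Model m from w) 0 = 0 from hw,
      add_zero]
  zero_mem' := rfl
  smul_mem' c v hv := by
    change c * (show Model m from v) 0 = 0
    rw [show (show Model m from v) 0 = 0 from hv, mul_zero]

instance (x : M) : FiniteDimensional ℝ (TangentSpace (𝓡∂ m) x) :=
  inferInstanceAs (FiniteDimensional ℝ (Model m))

variable [IsManifold (𝓡∂ m) ∞ M] (g : Metric m M)

/-- The coordinate expression of the metric in the preferred chart at `x`. -/
def localMetric (x : M) (y : Model m) : Model m →L[ℝ] Model m →L[ℝ] ℝ :=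
  ((chartInvDeriv x y).precomp ℝ).comp
    ((g.inner ((extChartAt (𝓡∂ m) x).symm y)).comp (chartInvDeriv x y))

/-- The scalar product on `Λ^p T_x^* M`. -/
def formInnerAt {p : ℕ} (x : M) (α β : FormAt m p x) : ℝ :=
  formInner (g.inner x) α β

/-- The Hodge Laplacian `Δ α = d δ α + δ d α` at `x`. -/
def hodgeLaplacianAt {p : ℕ} (α : ∀ z : M, FormAt m p z) (x : M) : FormAt m p x :=
  hodgeLaplacian (localMetric g x) (localForm x α) (pt m x)

/-- The connection Laplacian `∇^*∇ α` at `x`. -/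
def connLaplacianAt {p : ℕ} (α : ∀ z : M, FormAt m p z) (x : M) : FormAt m p x :=
  connLaplacian (localMetric g x) (localForm x α) (pt m x)

/-- `A` is the Weitzenböck tensor `R^W_p` at `x`, i.e. the endomorphism of `Λ^p T_x^* M` with
`Δ α = ∇^*∇ α - A α` at `x` for all smooth forms `α`. -/
def IsWeitzenbockTensor {p : ℕ} (x : M) (A : FormAt m p x →ₗ[ℝ] FormAt m p x) : Prop :=
  ∀ α : ∀ z : M, FormAt m p z, SmoothNear x α →
    hodgeLaplacianAt g α x = connLaplacianAt g α x - A (α x)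

/-- The curvature tensor `R(u, v) w = ∇_u ∇_v w - ∇_v ∇_u w - ∇_{[u, v]} w` at `x`. -/
def riemannAt (x : M) (u v w : TangentSpace (𝓡∂ m) x) : TangentSpace (𝓡∂ m) x :=
  riemann (localMetric g x) (pt m x) u v w

/-- The Ricci tensor `Ric(v, w) = tr (u ↦ R(u, v) w)` at `x`. -/
def ricciAt (x : M) (v w : TangentSpace (𝓡∂ m) x) : ℝ :=
  ∑ i, (show Model m from riemannAt g x (stdVec i) v w) i

/-- The Ricci operator on `T_x M`: the vector `Ric v = ∑ g^{ij} Ric(v, e_i) e_j`, which satisfies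
`g(Ric v, w) = Ric(v, w)`. -/
def ricciOp (x : M) (v : TangentSpace (𝓡∂ m) x) : TangentSpace (𝓡∂ m) x :=
  show Model m from ∑ i, ∑ j, (invGram (g.inner x) i j * ricciAt g x v (stdVec i)) • stdVec j

/-- The curvature operator `⟨ℛ(u ∧ v), u' ∧ v'⟩ = g(R(u, v) v', u')` on `Λ² T_x M` is non-negative:
`⟨ℛ ξ, ξ⟩ ≥ 0` for every bivector `ξ = ∑ₐ uₐ ∧ vₐ`. -/
def CurvatureOperatorNonneg (x : M) : Prop :=
  ∀ (n : ℕ) (u v : Fin n → TangentSpace (𝓡∂ m) x),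
    0 ≤ ∑ a, ∑ b, g.inner x (riemannAt g x (u a) (v a) (v b)) (u b)

/-- The inward unit normal vector at the boundary point `x`. -/
def normalAt (x : M) : TangentSpace (𝓡∂ m) x := unitNormal (localMetric g x) (pt m x)

/-- `S` is the boundary tensor `S_p` at the boundary point `x`: the symmetric endomorphism of
`Λ^p T_x^* M` which vanishes on the forms `α` with `i_ν α = 0` and satisfies
`(S α, α) = (α, i_ν dα) - (δ α, i_ν α) - ½ ∂_ν (α, α)` at `x` for all smooth forms `α` whose
restriction to the boundary is zero. -/
def IsBoundaryTensor {p : ℕ} (x : M) (S : FormAt m p x →ₗ[ℝ] FormAt m p x) : Prop :=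
  (∀ α β, formInnerAt g x (S α) β = formInnerAt g x α (S β)) ∧
  (∀ α : FormAt m p x, (∀ v, (∃ k, v k = normalAt g x) → α v = 0) → S α = 0) ∧
  ∀ α : ∀ z : M, FormAt m p z, SmoothNear x α → RestrictsToZeroNear x α →
    formInnerAt g x (S (α x)) (α x) = boundaryExpr (localMetric g x) (localForm x α) (pt m x)

/-- The metric on `T_x ∂M`. -/
def bdryMetric (x : M) : LinearMap.BilinForm ℝ (bdryTangent m x) :=
  LinearMap.mk₂ ℝ (fun v w => g.inner x v w) (by simp) (by simp) (by simp) (by simp)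

theorem bdryMetric_nondegenerate (x : M) : (bdryMetric g x).Nondegenerate := by
  refine ⟨fun v hv => ?_, fun v hv => ?_⟩ <;>
  · by_contra hne
    have h := g.pos x v (fun h => hne (Subtype.ext h))
    have h0 : g.inner x v v = 0 := hv v
    exact h.ne' h0

/-- The second fundamental form `l(v, w) = g(∇_v w, ν)` on `T_x ∂M`, with respect to the inward
unit normal `ν`. -/
def secondFormAt (x : M) : LinearMap.BilinForm ℝ (bdryTangent m x) :=
  LinearMap.BilinForm.restrict
    (show LinearMap.BilinForm ℝ (TangentSpace (𝓡∂ m) x) from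
      secondForm (localMetric g x) (pt m x))
    (bdryTangent m x)

/-- The second fundamental form operator `l : T_x ∂M → T_x ∂M`, `g(l v, w) = l(v, w)`. -/
def shapeOperator (x : M) : bdryTangent m x →ₗ[ℝ] bdryTangent m x :=
  ((bdryMetric g x).toDual (bdryMetric_nondegenerate g x)).symm.toLinearMap ∘ₗ secondFormAt g x

theorem bdryMetric_shapeOperator (x : M) (v w : bdryTangent m x) :
    bdryMetric g x (shapeOperator g x v) w = secondFormAt g x v w :=
  LinearMap.BilinForm.apply_toDual_symm_apply (hB := bdryMetric_nondegenerate g x) _ _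

/-- The sum of the `k` smallest eigenvalues of the second fundamental form operator at `x`; the
eigenvalues are the roots of its characteristic polynomial, listed with multiplicity. -/
def sumSmallestEigenvalues (x : M) (k : ℕ) : ℝ :=
  (((shapeOperator g x).charpoly.roots.sort (· ≤ ·)).take k).sum

end Manifold

end BoundaryGeometry

end

open scoped Manifold ContDiff Topology
open Set

noncomputable section

namespace BoundaryGeometry

/-! Everything is local, so the work is done in one chart of the half space, with one-sided
derivatives. Writing `alternatizeUncurryFin f` as `∑ e^a ∧ f(e_a)`, two facts about exterior algebra
carry the computations: `ι_v (∑ e^a ∧ f(e_a)) = f(v) - ∑ e^a ∧ ι_v f(e_a)`, and the adjointness of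
`e^a ∧` and `ι_{e_a}` for an orthonormal frame. `IsFrame.sum_invGram` turns the contractions with
`g^{ij}` in the definitions into traces over such a frame.

Weitzenböck part. The connection is torsion-free and metric, so `d` is the alternation and `δ` minus
the contraction of `∇α`, and both operations commute with `∇`. Hence `dδ + δd` is `-tr ∇²` plus a
term containing only the commutator of second covariant derivatives, which the Ricci identity makes
algebraic in `R` (`MetricAt.hodgeLaplacian_eq`). Uniqueness holds because every form at a point is
the value of a smooth form. In degree one the term contracts to `-Ric`. For the sign,
antisymmetrisation writes the quadratic form as minus a positive multiple of the pairing of the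
curvature operator with the Gram matrix of the forms `s_{ac} = (e_a ∧ e_c) · α`. A Gram matrix is a
sum of rank-one squares, and each of these pairs non-negatively with a non-negative curvature
operator (`IsFrame.weitzenbock_nonpos`).

Boundary part. Take principal directions `e_i` with eigenvalues `c_i`, completed by `ν`. If `α`
restricts to zero on the boundary, tangential derivatives of its tangential components vanish, so
those components of `∇_{e_i} α` involve only the normal part of the Christoffel symbols, that is,
the second fundamental form. The normal derivatives cancel, and the boundary expression is the
quadratic form of `ν♭ ∧ (l · ι_ν α - (tr l) ι_ν α)` (`IsFrame.boundary_identity`). This operator is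
symmetric and kills the forms with `ι_ν α = 0`; polarisation shows that it is the only such
operator. On the component of `ι_ν α` along `p - 1` distinct principal directions it acts as minus
the sum of the other `m - p` eigenvalues, and this sum is at least the sum of the `m - p` smallest
ones. -/

open ContinuousAlternatingMap (alternatizeUncurryFin alternatizeUncurryFin_apply
  alternatizeUncurryFin_add curryLeft_apply_apply curryLeftLI fderivCompContinuousLinearMapCLM
  fderivCompContinuousLinearMap_eq_alternatizeUncurryFin)

/-! ### Interior products, alternation and the derivation action on forms -/

section Forms

variable {m p : ℕ}

/-- The action of endomorphisms on forms as a continuous bilinear map. -/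
def formActionL (m p : ℕ) : (Model m →L[ℝ] Model m) →L[ℝ] Form m p →L[ℝ] Form m p :=
  (fderivCompContinuousLinearMapCLM ℝ (ContinuousLinearMap.id ℝ (Model m))).flip

@[simp]
theorem formActionL_apply (A : Model m →L[ℝ] Model m) (α : Form m p) :
    formActionL m p A α = formAction A α := rfl

/-- The interior product as a continuous bilinear map. -/
def interiorL (m p : ℕ) : Model m →L[ℝ] Form m (p + 1) →L[ℝ] Form m p :=
  (curryLeftLI (𝕜 := ℝ) (E := Model m) (F := ℝ) (n := p)).toContinuousLinearMap.flip

@[simp]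
theorem interiorL_apply (v : Model m) (α : Form m (p + 1)) :
    interiorL m p v α = α.curryLeft v := rfl

theorem form_ext_curryLeft {α β : Form m (p + 1)} (h : ∀ v, α.curryLeft v = β.curryLeft v) :
    α = β := by
  ext v
  have := DFunLike.congr_fun (h (v 0)) (Matrix.vecTail v)
  rwa [curryLeft_apply_apply, curryLeft_apply_apply,
    show Matrix.vecCons (v 0) (Matrix.vecTail v) = v from Matrix.cons_head_tail v] at this

theorem formAction_zero_form (A : Model m →L[ℝ] Model m) (α : Form m 0) : formAction A α = 0 := by
  ext v
  simp [formAction_apply]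

theorem curryLeft_alternatizeUncurryFin_zero (f : Model m →L[ℝ] Form m 0) (v : Model m) :
    (alternatizeUncurryFin f).curryLeft v = f v := by
  ext w
  simp only [curryLeft_apply_apply, alternatizeUncurryFin_apply]
  simp

/-- Only the summand that puts the first argument into `f` escapes the contraction; all other
summands move one place, which gives the sign. This is the antiderivation rule for `ι_v` and drives
the inductions on the degree below. -/
theorem curryLeft_alternatizeUncurryFin (f : Model m →L[ℝ] Form m (p + 1)) (v : Model m) :
    (alternatizeUncurryFin f).curryLeft v =
      f v - alternatizeUncurryFin (interiorL m p v ∘L f) := by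
  ext w
  simp only [curryLeft_apply_apply, alternatizeUncurryFin_apply,
    ContinuousAlternatingMap.sub_apply]
  rw [Fin.sum_univ_succ]
  simp only [Matrix.cons_val_zero, Matrix.cons_val_succ, Fin.val_zero, pow_zero, one_smul,
    sub_eq_add_neg, ← Finset.sum_neg_distrib]
  congr 1
  refine Finset.sum_congr rfl fun i _ => ?_
  simp only [Fin.val_succ, pow_succ, mul_neg, mul_one, neg_smul, ContinuousLinearMap.comp_apply,
    interiorL_apply, curryLeft_apply_apply]
  congr 3
  ext j k
  cases j using Fin.cases <;> simp [Fin.removeNth]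

theorem curryLeft_formAction (A : Model m →L[ℝ] Model m) (α : Form m (p + 1)) (v : Model m) :
    (formAction A α).curryLeft v = formAction A (α.curryLeft v) + α.curryLeft (A v) := by
  ext w
  simp only [curryLeft_apply_apply, formAction_apply, ContinuousAlternatingMap.add_apply]
  rw [Fin.sum_univ_succ, add_comm]
  congr 1
  · refine Finset.sum_congr rfl fun i _ => ?_
    congr 1
    funext j
    cases j using Fin.cases <;> simp [Function.update_apply, Fin.succ_ne_zero, Ne.symm]
  · congr 1
    funext j
    cases j using Fin.cases <;> simp

theorem formAction_eq_alternatizeUncurryFin (A : Model m →L[ℝ] Model m) (α : Form m (p + 1)) :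
    formAction A α = alternatizeUncurryFin (α.curryLeft ∘L A) := by
  rw [formAction, fderivCompContinuousLinearMap_eq_alternatizeUncurryFin]
  rfl

/-- A derivation acts on `∑ e^a ∧ f(e_a)` through the values of `f` and through its argument.
Applied to Christoffel symbols, this makes covariant differentiation commute with alternation. -/
theorem formAction_alternatizeUncurryFin (A : Model m →L[ℝ] Model m)
    (f : Model m →L[ℝ] Form m p) :
    formAction A (alternatizeUncurryFin f) =
      alternatizeUncurryFin (formActionL m p A ∘L f + f ∘L A) := by
  induction p with
  | zero =>
    refine form_ext_curryLeft fun v => ?_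
    rw [curryLeft_formAction]
    simp [curryLeft_alternatizeUncurryFin_zero, formAction_zero_form]
  | succ p ih =>
    refine form_ext_curryLeft fun v => ?_
    rw [curryLeft_formAction]
    simp only [curryLeft_alternatizeUncurryFin]
    have h : interiorL m p v ∘L (formActionL m (p + 1) A ∘L f + f ∘L A) =
        (formActionL m p A ∘L (interiorL m p v ∘L f) + (interiorL m p v ∘L f) ∘L A)
          + interiorL m p (A v) ∘L f := by
      ext1 w
      simp [curryLeft_formAction]
      abel
    rw [h, alternatizeUncurryFin_add, ← ih, ← formActionL_apply, map_sub]
    simp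
    abel

/-- The action on forms is dual to that on vectors, so commutators change sign; this is the source
of the sign in the Ricci identity. -/
theorem formAction_comm (A B : Model m →L[ℝ] Model m) (α : Form m p) :
    formAction A (formAction B α) - formAction B (formAction A α) =
      - formAction (A ∘L B - B ∘L A) α := by
  induction p with
  | zero => simp [formAction_zero_form]
  | succ p ih =>
    refine form_ext_curryLeft fun v => ?_
    have key : ∀ A B : Model m →L[ℝ] Model m, (formAction A (formAction B α)).curryLeft v =
        formAction A (formAction B (α.curryLeft v)) + formAction A (α.curryLeft (B v)) +
          formAction B (α.curryLeft (A v)) + α.curryLeft (B (A v)) := by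
      intro A B
      rw [curryLeft_formAction, curryLeft_formAction, curryLeft_formAction,
        ← formActionL_apply A (_ + _), map_add]
      simp only [formActionL_apply]
      abel
    have hs : (formAction A (formAction B α) - formAction B (formAction A α)).curryLeft v =
      (formAction A (formAction B α)).curryLeft v - (formAction B (formAction A α)).curryLeft v :=
      rfl
    have hn : (- formAction (A ∘L B - B ∘L A) α).curryLeft v =
      - (formAction (A ∘L B - B ∘L A) α).curryLeft v := rfl
    rw [hs, hn, key, key, curryLeft_formAction, neg_add, ← ih]
    rw [show (A ∘L B - B ∘L A) v = A (B v) - B (A v) from rfl, map_sub]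
    abel

end Forms

/-! ### Scalar products of forms in orthonormal frames -/

section Inner

variable {m p : ℕ}

/-- A continuous bilinear form which is a scalar product. -/
structure IsScalarProduct (b : Model m →L[ℝ] Model m →L[ℝ] ℝ) : Prop where
  symm : ∀ v w, b v w = b w v
  pos : ∀ v, v ≠ 0 → 0 < b v v

/-- The scalar product of forms as a bilinear form. -/
def formInnerB (b : Model m →L[ℝ] Model m →L[ℝ] ℝ) : Form m p →ₗ[ℝ] Form m p →ₗ[ℝ] ℝ :=
  LinearMap.mk₂ ℝ (formInner b)
    (fun α α' β => by
      simp only [formInner, Finset.sum_add_distrib,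
        ContinuousAlternatingMap.add_apply, mul_add, add_mul])
    (fun c α β => by
      simp only [formInner, Finset.mul_sum, smul_eq_mul, ContinuousAlternatingMap.smul_apply]
      refine Finset.sum_congr rfl fun I _ => Finset.sum_congr rfl fun J _ => by ring)
    (fun α β β' => by
      simp only [formInner, ← mul_add, ← Finset.sum_add_distrib,
        ContinuousAlternatingMap.add_apply])
    (fun c α β => by
      simp only [formInner, Finset.mul_sum, smul_eq_mul, ContinuousAlternatingMap.smul_apply]
      refine Finset.sum_congr rfl fun I _ => Finset.sum_congr rfl fun J _ => by ring)

theorem formInnerB_apply (b : Model m →L[ℝ] Model m →L[ℝ] ℝ) (α β : Form m p) :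
    formInnerB b α β = formInner b α β := rfl

theorem formInnerB_zero_form (b : Model m →L[ℝ] Model m →L[ℝ] ℝ) (α β : Form m 0) :
    formInnerB b α β = α ![] * β ![] := by
  simp only [formInnerB_apply, formInner, Finset.univ_unique, Finset.sum_singleton,
    Finset.univ_eq_empty, Finset.prod_empty, Nat.factorial_zero, Nat.cast_one, inv_one, one_mul]
  congr 2 <;> exact Subsingleton.elim _ _

/-- Splitting off the first index of both multi-indices gives a recursion in the degree; it replaces
multi-index sums by induction. -/
theorem formInnerB_succ (b : Model m →L[ℝ] Model m →L[ℝ] ℝ) (α β : Form m (p + 1)) :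
    formInnerB b α β = ((p : ℝ) + 1)⁻¹ * ∑ i, ∑ j, invGram b i j *
      formInnerB b (α.curryLeft (stdVec i)) (β.curryLeft (stdVec j)) := by
  have hcons : ∀ (i : Fin m) (I : Fin p → Fin m),
      (fun k => (stdVec (Fin.cons (α := fun _ => Fin m) i I k) : Model m)) =
        Matrix.vecCons (stdVec i) fun k => stdVec (I k) := by
    intro i I
    funext k
    cases k using Fin.cases <;> simp
  simp only [formInnerB_apply, formInner, curryLeft_apply_apply]
  rw [Nat.factorial_succ, Nat.cast_mul, mul_inv, mul_assoc, Nat.cast_add, Nat.cast_one]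
  congr 1
  rw [← (Fin.consEquiv fun _ => Fin m).sum_comp, Fintype.sum_prod_type, Finset.mul_sum]
  refine Finset.sum_congr rfl fun i _ => ?_
  simp_rw [← (Fin.consEquiv fun _ => Fin m).sum_comp (fun J : Fin (p + 1) → Fin m => _),
    Fintype.sum_prod_type]
  rw [Finset.sum_comm, Finset.mul_sum]
  refine Finset.sum_congr rfl fun j _ => ?_
  rw [mul_left_comm]
  congr 1
  rw [Finset.mul_sum]
  refine Finset.sum_congr rfl fun I _ => ?_
  rw [Finset.mul_sum]
  refine Finset.sum_congr rfl fun J _ => ?_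
  simp only [Fin.consEquiv_apply, hcons, Fin.prod_univ_succ, Fin.cons_zero, Fin.cons_succ]
  ring

theorem invGram_symm {b : Model m →L[ℝ] Model m →L[ℝ] ℝ} (h : ∀ v w, b v w = b w v)
    (i j : Fin m) : invGram b i j = invGram b j i := by
  have : (Matrix.of fun k l : Fin m => b (stdVec k) (stdVec l)).transpose =
      Matrix.of fun k l : Fin m => b (stdVec k) (stdVec l) := by
    ext k l
    simp [h]
  unfold invGram
  conv_rhs => rw [← this, ← Matrix.transpose_nonsing_inv, Matrix.transpose_apply]

theorem formInnerB_symm {b : Model m →L[ℝ] Model m →L[ℝ] ℝ} (h : ∀ v w, b v w = b w v)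
    (α β : Form m p) : formInnerB b α β = formInnerB b β α := by
  induction p with
  | zero => simp [formInnerB_zero_form, mul_comm]
  | succ p ih =>
    rw [formInnerB_succ, formInnerB_succ, Finset.sum_comm]
    congr 1
    refine Finset.sum_congr rfl fun i _ => Finset.sum_congr rfl fun j _ => ?_
    rw [ih, invGram_symm h]

theorem sum_smul_stdVec (v : Model m) : ∑ i, v i • stdVec i = v := by
  ext k
  simp [stdVec, Pi.single_apply]

/-- An orthonormal basis of a scalar product, indexed by an arbitrary finite type. -/
structure IsFrame {ι : Type*} [Fintype ι] [DecidableEq ι] (b : Model m →L[ℝ] Model m →L[ℝ] ℝ)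
    (e : ι → Model m) : Prop where
  ortho : ∀ a c, b (e a) (e c) = if a = c then 1 else 0
  expand : ∀ v, v = ∑ a, b v (e a) • e a

namespace IsFrame

variable {ι : Type*} [Fintype ι] [DecidableEq ι] {b : Model m →L[ℝ] Model m →L[ℝ] ℝ}
  {e : ι → Model m}

/-- Expanding `e_k` in the frame says exactly that the Gram matrix times `∑ e_a e_aᵀ` is the
identity. -/
theorem invGram_eq (he : IsFrame b e) (i j : Fin m) :
    invGram b i j = ∑ a, e a i * e a j := by
  unfold invGram
  rw [Matrix.inv_eq_right_inv (B := Matrix.of fun i j => ∑ a, e a i * e a j)]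
  · rfl
  · ext k l
    have h1 : ∀ a, b (stdVec k) (e a) = ∑ x, b (stdVec k) (stdVec x) * e a x := by
      intro a
      conv_lhs => rw [← sum_smul_stdVec (e a)]
      simp [mul_comm]
    have h2 := congrArg (fun v : Model m => v l) (he.expand (stdVec k))
    simp only [Matrix.mul_apply, Matrix.of_apply, Finset.mul_sum]
    rw [Finset.sum_comm]
    simp only [WithLp.ofLp_sum, Finset.sum_apply, smul_eq_mul, h1,
      Finset.sum_mul, WithLp.ofLp_smul, Pi.smul_apply] at h2
    simp only [← mul_assoc]
    rw [← h2, Matrix.one_apply, stdVec, EuclideanSpace.single, PiLp.single_apply]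
    simp [eq_comm]

theorem sum_invGram {F : Type*} [AddCommGroup F] [Module ℝ F] (he : IsFrame b e)
    (T : Model m →ₗ[ℝ] Model m →ₗ[ℝ] F) :
    ∑ i, ∑ j, invGram b i j • T (stdVec i) (stdVec j) = ∑ a, T (e a) (e a) := by
  have h : ∀ a, T (e a) (e a) = ∑ i, ∑ j, (e a i * e a j) • T (stdVec i) (stdVec j) := by
    intro a
    conv_lhs => rw [← sum_smul_stdVec (e a)]
    simp only [map_sum, map_smul, LinearMap.sum_apply, LinearMap.smul_apply, Finset.smul_sum,
      smul_smul]
    rw [Finset.sum_comm]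
    exact Finset.sum_congr rfl fun i _ => Finset.sum_congr rfl fun j _ => by rw [mul_comm]
  simp only [h, he.invGram_eq, Finset.sum_smul]
  conv_rhs => rw [Finset.sum_comm]
  refine Finset.sum_congr rfl fun i _ => ?_
  rw [Finset.sum_comm]

theorem map_expand {F : Type*} [AddCommGroup F] [Module ℝ F] (he : IsFrame b e)
    (f : Model m →ₗ[ℝ] F) (v : Model m) : f v = ∑ a, b v (e a) • f (e a) := by
  conv_lhs => rw [he.expand v]
  simp

theorem formInnerB_succ (he : IsFrame b e) (α β : Form m (p + 1)) :
    formInnerB b α β = ((p : ℝ) + 1)⁻¹ * ∑ a,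
      formInnerB b (α.curryLeft (e a)) (β.curryLeft (e a)) := by
  rw [BoundaryGeometry.formInnerB_succ]
  congr 1
  exact he.sum_invGram ((formInnerB b).compl₁₂ (α.curryLeft : Model m →ₗ[ℝ] Form m p)
    (β.curryLeft : Model m →ₗ[ℝ] Form m p))

theorem formInnerB_eq (he : IsFrame b e) (α β : Form m p) :
    formInnerB b α β = (p.factorial : ℝ)⁻¹ * ∑ I : Fin p → ι,
      α (fun k => e (I k)) * β (fun k => e (I k)) := by
  induction p with
  | zero =>
    simp [formInnerB_zero_form, Matrix.empty_eq]
  | succ p ih =>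
    rw [he.formInnerB_succ, Nat.factorial_succ, Nat.cast_mul, mul_inv, mul_assoc, Nat.cast_add,
      Nat.cast_one]
    congr 1
    rw [← (Fin.consEquiv fun _ => ι).sum_comp, Fintype.sum_prod_type, Finset.mul_sum]
    refine Finset.sum_congr rfl fun a _ => ?_
    rw [ih]
    congr 1
    refine Finset.sum_congr rfl fun I _ => ?_
    have hcons : (fun k => e (Fin.cons (α := fun _ => ι) a I k)) =
        Matrix.vecCons (e a) fun k => e (I k) := by
      funext k
      cases k using Fin.cases <;> simp
    simp only [Fin.consEquiv_apply, hcons, curryLeft_apply_apply]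

theorem eq_zero_of_forall (he : IsFrame b e) (α : Form m p)
    (h : ∀ I : Fin p → ι, α (fun k => e (I k)) = 0) : α = 0 := by
  induction p with
  | zero =>
    ext v
    have := h (fun k => k.elim0)
    rwa [Subsingleton.elim (fun k : Fin 0 => e (k.elim0)) v] at this
  | succ p ih =>
    refine form_ext_curryLeft fun v => ?_
    rw [he.expand v, map_sum, map_sum]
    refine Finset.sum_congr rfl fun a _ => ?_
    rw [map_smul, map_smul]
    congr 1
    refine ih _ fun I => ?_
    rw [← h (Fin.cons a I), curryLeft_apply_apply]
    congr 1
    funext k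
    cases k using Fin.cases <;> simp

theorem formInnerB_self_eq_zero (he : IsFrame b e) {α : Form m p} (h : formInnerB b α α = 0) :
    α = 0 := by
  rw [he.formInnerB_eq, mul_eq_zero, or_iff_right (by positivity),
    Finset.sum_eq_zero_iff_of_nonneg fun I _ => mul_self_nonneg _] at h
  exact he.eq_zero_of_forall α fun I => mul_self_eq_zero.1 (h I (Finset.mem_univ _))

theorem curryLeft_anticomm (α : Form m (p + 2)) (v w : Model m) :
    (α.curryLeft v).curryLeft w = - (α.curryLeft w).curryLeft v := by
  have h := ContinuousAlternatingMap.curryLeft_same α (v + w)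
  have hadd : ∀ u, (α.curryLeft (v + w)).curryLeft u =
      (α.curryLeft v).curryLeft u + (α.curryLeft w).curryLeft u := by
    intro u
    rw [map_add]
    rfl
  rw [hadd, map_add, map_add, ContinuousAlternatingMap.curryLeft_same,
    ContinuousAlternatingMap.curryLeft_same, zero_add, add_zero] at h
  exact eq_neg_of_add_eq_zero_left h

/-- This is the adjointness of `e^a ∧` and `ι_{e_a}`. In the induction, the antiderivation rule
produces the right-hand side `S` once directly and `p + 1` times from the double contraction, whose
anticommutativity cancels the minus sign; the normalisation `1/(p + 2)` absorbs the total. -/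
theorem formInnerB_alternatizeUncurryFin (he : IsFrame b e) (f : Model m →L[ℝ] Form m p)
    (β : Form m (p + 1)) :
    formInnerB b (alternatizeUncurryFin f) β =
      ∑ a, formInnerB b (f (e a)) (β.curryLeft (e a)) := by
  induction p with
  | zero =>
    rw [he.formInnerB_succ]
    simp [curryLeft_alternatizeUncurryFin_zero]
  | succ p ih =>
    rw [he.formInnerB_succ]
    simp only [curryLeft_alternatizeUncurryFin, map_sub, LinearMap.sub_apply,
      Finset.sum_sub_distrib, ih]
    have : ∑ a, ∑ c, formInnerB b ((interiorL m p (e a) ∘L f) (e c))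
        ((β.curryLeft (e a)).curryLeft (e c)) =
        - (((p : ℝ) + 1) * ∑ a, formInnerB b (f (e a)) (β.curryLeft (e a))) := by
      rw [Finset.sum_comm, Finset.mul_sum, ← Finset.sum_neg_distrib]
      refine Finset.sum_congr rfl fun c _ => ?_
      rw [he.formInnerB_succ, mul_inv_cancel_left₀ (by positivity), ← Finset.sum_neg_distrib]
      refine Finset.sum_congr rfl fun a _ => ?_
      rw [curryLeft_anticomm, map_neg]
      rfl
    rw [this]
    push_cast
    field_simp
    ring

/-- Since `A · α = ∑ e^a ∧ ι_{A e_a} α`, both sides become the double sum of `b(A e_a, e_c) (ι_c α,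
ι_a β)`. -/
theorem formInnerB_formAction (he : IsFrame b e) {A A' : Model m →L[ℝ] Model m}
    (hA : ∀ v w, b (A v) w = b v (A' w)) (hb : ∀ v w, b v w = b w v) (α β : Form m p) :
    formInnerB b (formAction A α) β = formInnerB b α (formAction A' β) := by
  cases p with
  | zero => simp [formAction_zero_form]
  | succ p =>
    rw [formInnerB_symm hb α, formAction_eq_alternatizeUncurryFin,
      formAction_eq_alternatizeUncurryFin, he.formInnerB_alternatizeUncurryFin,
      he.formInnerB_alternatizeUncurryFin]
    have h1 : ∀ a, formInnerB b ((α.curryLeft ∘L A) (e a)) (β.curryLeft (e a)) =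
        ∑ c, b (A (e a)) (e c) * formInnerB b (α.curryLeft (e c)) (β.curryLeft (e a)) := fun a =>
      he.map_expand ((formInnerB b).flip (β.curryLeft (e a)) ∘ₗ
        (α.curryLeft : Model m →ₗ[ℝ] Form m p)) (A (e a))
    have h2 : ∀ c, formInnerB b ((β.curryLeft ∘L A') (e c)) (α.curryLeft (e c)) =
        ∑ a, b (e a) (A' (e c)) * formInnerB b (α.curryLeft (e c)) (β.curryLeft (e a)) := by
      intro c
      refine (he.map_expand ((formInnerB b).flip (α.curryLeft (e c)) ∘ₗ
        (β.curryLeft : Model m →ₗ[ℝ] Form m p)) (A' (e c))).trans ?_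
      refine Finset.sum_congr rfl fun a _ => ?_
      rw [hb, formInnerB_symm hb (α.curryLeft (e c))]
      rfl
    simp only [h1, h2, hA]
    exact Finset.sum_comm

end IsFrame

/-- Symmetric operators have an orthonormal basis of eigenvectors. -/
theorem exists_orthonormal_eigenbasis {V : Type*} [AddCommGroup V] [Module ℝ V]
    [FiniteDimensional ℝ V] (B : LinearMap.BilinForm ℝ V) (hsymm : ∀ v w, B v w = B w v)
    (hpos : ∀ v, v ≠ 0 → 0 < B v v) (L : V →ₗ[ℝ] V) (hL : ∀ v w, B (L v) w = B v (L w)) :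
    ∃ (e : Module.Basis (Fin (Module.finrank ℝ V)) ℝ V) (c : Fin (Module.finrank ℝ V) → ℝ),
      (∀ i j, B (e i) (e j) = if i = j then 1 else 0) ∧ (∀ i, L (e i) = c i • e i) := by
  -- The form `B` itself is made the inner product of `V`, so that the spectral theorem applies to
  -- `L`.
  let core : InnerProductSpace.Core ℝ V :=
    { inner := fun v w => B v w
      conj_inner_symm := fun v w => by simp [hsymm v w]
      re_inner_nonneg := fun v => by
        rcases eq_or_ne v 0 with rfl | h
        · simp
        · exact (hpos v h).le
      add_left := fun u v w => by simp
      smul_left := fun u v c => by simp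
      definite := fun v h => by
        by_contra hne
        exact (hpos v hne).ne' h }
  let _ : NormedAddCommGroup V := core.toNormedAddCommGroup
  let _ : InnerProductSpace ℝ V := InnerProductSpace.ofCore core.toCore
  have hs : L.IsSymmetric := fun v w => hL v w
  refine ⟨(hs.eigenvectorBasis rfl).toBasis, hs.eigenvalues rfl, fun i j => ?_, fun i => ?_⟩
  · have := (hs.eigenvectorBasis rfl).inner_eq_ite i j
    rw [OrthonormalBasis.coe_toBasis]
    exact this
  · simp [hs.apply_eigenvectorBasis rfl i]

theorem IsFrame.of_basis {ι : Type*} [Fintype ι] [DecidableEq ι]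
    {b : Model m →L[ℝ] Model m →L[ℝ] ℝ} (e : Module.Basis ι ℝ (Model m))
    (h : ∀ i j, b (e i) (e j) = if i = j then 1 else 0) : IsFrame b e where
  ortho := h
  expand v := by
    have h1 : ∀ a, b v (e a) = e.repr v a := by
      intro a
      conv_lhs => rw [← e.sum_repr v]
      simp only [map_sum, map_smul, FunLike.coe_sum, Finset.sum_apply, FunLike.coe_smul,
        Pi.smul_apply, h]
      simp
    simp only [h1, e.sum_repr]

theorem IsScalarProduct.exists_frame {b : Model m →L[ℝ] Model m →L[ℝ] ℝ}
    (hb : IsScalarProduct b) :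
    ∃ e : Fin (Module.finrank ℝ (Model m)) → Model m, IsFrame b e := by
  obtain ⟨e, -, he, -⟩ := exists_orthonormal_eigenbasis
    (LinearMap.mk₂ ℝ (fun v w => b v w) (by simp) (by simp) (by simp) (by simp))
    (fun v w => hb.symm v w) (fun v => hb.pos v) 0 (by simp)
  exact ⟨e, IsFrame.of_basis e he⟩

end Inner

/-! ### The algebraic curvature term, its degree-one case and its sign -/

section Weitzenbock

variable {m p : ℕ}

theorem map_eq_sum_stdVec {F : Type*} [AddCommGroup F] [Module ℝ F] (f : Model m →ₗ[ℝ] F)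
    (v : Model m) : f v = ∑ i, v i • f (stdVec i) := by
  conv_lhs => rw [← sum_smul_stdVec v]
  simp

theorem formAction_neg (A : Model m →L[ℝ] Model m) (α : Form m p) :
    formAction (-A) α = - formAction A α := by
  rw [← formActionL_apply, map_neg]
  rfl

/-- The form `∑ₖ e^k ∧ ι_w (R(e_k, v) · α)`. -/
def curvatureTerm (R : Model m →L[ℝ] Model m →L[ℝ] Model m →L[ℝ] Model m) :
    Form m (p + 1) →ₗ[ℝ] Model m →ₗ[ℝ] Model m →ₗ[ℝ] Form m (p + 1) :=
  LinearMap.mk₂ ℝ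
    (fun α v => (ContinuousAlternatingMap.alternatizeUncurryFinCLM ℝ (Model m) ℝ).toLinearMap ∘ₗ
      ((ContinuousLinearMap.compL ℝ (Model m) (Form m (p + 1)) (Form m p)).flip
        ((formActionL m (p + 1)).flip α ∘L R.flip v)).toLinearMap ∘ₗ (interiorL m p).toLinearMap)
    (fun α α' v => by ext1 w; simp [ContinuousLinearMap.add_comp])
    (fun c α v => by ext1 w; simp [ContinuousLinearMap.smul_comp])
    (fun α v v' => by ext1 w; simp [ContinuousLinearMap.comp_add])
    (fun c α v => by ext1 w; simp)

theorem curvatureTerm_apply (R : Model m →L[ℝ] Model m →L[ℝ] Model m →L[ℝ] Model m)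
    (α : Form m (p + 1)) (v w : Model m) :
    curvatureTerm R α v w = alternatizeUncurryFin
      (interiorL m p w ∘L (formActionL m (p + 1)).flip α ∘L R.flip v) := rfl

/-- The Weitzenböck operator `α ↦ - ∑ g^{ij} e^k ∧ ι_{e_j} (R(e_k, e_i) · α)` built from a scalar
product and a curvature tensor. -/
def weitzenbock (b : Model m →L[ℝ] Model m →L[ℝ] ℝ)
    (R : Model m →L[ℝ] Model m →L[ℝ] Model m →L[ℝ] Model m) :
    (p : ℕ) → Form m p →ₗ[ℝ] Form m p
  | 0 => 0
  | _ + 1 => - ∑ i, ∑ j, invGram b i j •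
      ((curvatureTerm R).flip (stdVec i)).flip (stdVec j)

namespace IsFrame

variable {ι : Type*} [Fintype ι] [DecidableEq ι] {b : Model m →L[ℝ] Model m →L[ℝ] ℝ}
  {e : ι → Model m} {R : Model m →L[ℝ] Model m →L[ℝ] Model m →L[ℝ] Model m}

theorem weitzenbock_succ (he : IsFrame b e) (α : Form m (p + 1)) :
    weitzenbock b R (p + 1) α = - ∑ a, curvatureTerm R α (e a) (e a) := by
  rw [← he.sum_invGram (curvatureTerm R α)]
  simp [weitzenbock]

/-- Both the trace defining Ricci and the raising of its index become frame sums; the antisymmetries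
of `R` then identify the Ricci operator with `v ↦ ∑ R(v, e_a) e_a`. -/
theorem ricci_contraction (he : IsFrame b e) (hb : ∀ v w, b v w = b w v)
    (hR : ∀ u v, R u v = - R v u) (hskew : ∀ u v w w', b (R u v w) w' = - b w (R u v w'))
    (v : Model m) :
    ∑ i, ∑ j, (invGram b i j * ∑ k, R (stdVec k) v (stdVec i) k) • (stdVec j : Model m) =
      ∑ a, R v (e a) (e a) := by
  have htr : ∀ w, ∑ k, R (stdVec k) v w k = ∑ c, b (R (e c) v w) (e c) := by
    intro w
    have h1 : ∀ k, R (stdVec k) v w k = ∑ c, b (R (stdVec k) v w) (e c) * e c k := fun k => by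
      simpa using congrArg (fun x : Model m => x k) (he.expand (R (stdVec k) v w))
    have h2 : ∀ c, b (R (e c) v w) (e c) = ∑ k, b (R (stdVec k) v w) (e c) * e c k := fun c => by
      refine (map_eq_sum_stdVec ((b.flip (e c)).toLinearMap ∘ₗ
        ((R.flip v).flip w).toLinearMap) (e c)).trans ?_
      exact Finset.sum_congr rfl fun k _ => mul_comm _ _
    simp only [h1, h2]
    exact Finset.sum_comm
  have h := he.sum_invGram (LinearMap.mk₂ ℝ
    (fun u w : Model m => (∑ c, b (R (e c) v u) (e c)) • w)
    (fun _ _ _ => by simp [Finset.sum_add_distrib, add_smul])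
    (fun _ _ _ => by simp [← Finset.mul_sum, smul_smul]) (fun _ _ _ => smul_add _ _ _)
    (fun _ _ _ => smul_comm _ _ _))
  simp only [htr, mul_smul]
  refine h.trans ?_
  simp only [LinearMap.mk₂_apply, Finset.sum_smul]
  rw [Finset.sum_comm]
  refine Finset.sum_congr rfl fun c _ => ?_
  rw [he.expand (R v (e c) (e c))]
  refine Finset.sum_congr rfl fun a _ => ?_
  congr 1
  rw [hR (e c) v, hskew v (e c), hb]
  simp

theorem weitzenbock_one (he : IsFrame b e) (hb : ∀ v w, b v w = b w v)
    (hR : ∀ u v, R u v = - R v u) (hskew : ∀ u v w w', b (R u v w) w' = - b w (R u v w'))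
    (α : Form m 1) (v : Fin 1 → Model m) :
    weitzenbock b R 1 α v = - α (fun k => ∑ i, ∑ j,
      (invGram b i j * ∑ l, R (stdVec l) (v k) (stdVec i) l) • stdVec j) := by
  have h1 : ∀ w : Model m, α (fun _ => w) = α.curryLeft w ![] := by
    intro w
    rw [curryLeft_apply_apply]
    congr 1
    funext k
    rw [Subsingleton.elim k 0]
    rfl
  have h2 : (fun k => ∑ i, ∑ j,
      (invGram b i j * ∑ l, R (stdVec l) (v k) (stdVec i) l) • stdVec j) =
      fun _ => ∑ a, R (v 0) (e a) (e a) := by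
    funext k
    rw [Subsingleton.elim k 0]
    exact he.ricci_contraction hb hR hskew (v 0)
  rw [h2, h1, he.weitzenbock_succ, map_sum]
  simp only [ContinuousAlternatingMap.neg_apply, ContinuousAlternatingMap.sum_apply]
  congr 1
  refine Finset.sum_congr rfl fun a _ => ?_
  rw [curvatureTerm_apply, alternatizeUncurryFin_apply]
  simp [curryLeft_formAction, formAction_zero_form, Matrix.empty_eq]

end IsFrame

/-- The skew-symmetric operator `u ↦ b(v, u) w - b(w, u) v`. -/
def skewOp (b : Model m →L[ℝ] Model m →L[ℝ] ℝ) (v w : Model m) : Model m →L[ℝ] Model m :=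
  (b v).smulRight w - (b w).smulRight v

theorem skewOp_apply (b : Model m →L[ℝ] Model m →L[ℝ] ℝ) (v w u : Model m) :
    skewOp b v w u = b v u • w - b w u • v := rfl

theorem skewOp_skew {b : Model m →L[ℝ] Model m →L[ℝ] ℝ} (hb : ∀ v w, b v w = b w v)
    (v w x y : Model m) : b (skewOp b v w x) y = b x ((- skewOp b v w) y) := by
  simp only [skewOp_apply, map_sub, map_smul, sub_apply, neg_apply, map_neg, FunLike.coe_smul,
    Pi.smul_apply, smul_eq_mul, hb x v, hb x w]
  ring

namespace IsFrame

variable {ι : Type*} [Fintype ι] [DecidableEq ι] {b : Model m →L[ℝ] Model m →L[ℝ] ℝ}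
  {e : ι → Model m} {R : Model m →L[ℝ] Model m →L[ℝ] Model m →L[ℝ] Model m}

/-- The antisymmetrised contractions of `α` against `β` are the action of the elementary rotation in
the plane of `e_a` and `e_c`. This is how the curvature term becomes a pairing with bivectors. -/
theorem formInnerB_skewOp (he : IsFrame b e) (α β : Form m (p + 1)) (a c : ι) :
    formInnerB b (formAction (skewOp b (e c) (e a)) α) β =
      formInnerB b (α.curryLeft (e a)) (β.curryLeft (e c)) -
        formInnerB b (α.curryLeft (e c)) (β.curryLeft (e a)) := by
  rw [formAction_eq_alternatizeUncurryFin, he.formInnerB_alternatizeUncurryFin]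
  simp only [ContinuousLinearMap.comp_apply, skewOp_apply, he.ortho, map_sub,
    LinearMap.sub_apply, Finset.sum_sub_distrib, ite_smul, one_smul, zero_smul]
  rw [Finset.sum_eq_single c (fun x _ h => by simp [h.symm]) (by simp),
    Finset.sum_eq_single a (fun x _ h => by simp [h.symm]) (by simp), if_pos rfl, if_pos rfl]

/-- Each coordinate plane occurs twice in the double sum, hence the factor `1/2`. -/
theorem eq_sum_skewOp (he : IsFrame b e) (hb : ∀ v w, b v w = b w v)
    {A : Model m →L[ℝ] Model m} (hA : ∀ v w, b (A v) w = - b v (A w)) :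
    A = (1 / 2 : ℝ) • ∑ a, ∑ c, b (A (e a)) (e c) • skewOp b (e a) (e c) := by
  ext1 w
  simp only [FunLike.coe_smul, Pi.smul_apply, FunLike.coe_sum, Finset.sum_apply, skewOp_apply,
    smul_sub, Finset.sum_sub_distrib]
  have h1 : ∑ a, ∑ c, b (A (e a)) (e c) • b (e a) w • e c = A w := by
    rw [Finset.sum_comm, he.expand (A w)]
    refine Finset.sum_congr rfl fun c _ => ?_
    have := he.map_expand ((b.flip (e c)).toLinearMap ∘ₗ A.toLinearMap) w
    simp only [LinearMap.comp_apply, ContinuousLinearMap.coe_coe, ContinuousLinearMap.flip_apply,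
      smul_eq_mul] at this
    rw [this, Finset.sum_smul]
    exact Finset.sum_congr rfl fun a _ => by rw [smul_smul, mul_comm, hb w]
  have h2 : ∑ a, ∑ c, b (A (e a)) (e c) • b (e c) w • e a = - A w := by
    rw [← h1, Finset.sum_comm, ← Finset.sum_neg_distrib]
    refine Finset.sum_congr rfl fun c _ => ?_
    rw [← Finset.sum_neg_distrib]
    refine Finset.sum_congr rfl fun a _ => ?_
    rw [hA, hb, neg_smul]
  rw [h1, h2]
  module

/-- Up to a positive factor the quadratic form is `∑ R_{cadf} (s_{df}, s_{ca})`, where `R_{cadf} =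
b(R(e_c, e_a) e_d, e_f)`; `hcurv` makes every rank-one version of this sum non-positive. -/
theorem weitzenbock_nonpos (he : IsFrame b e) (hb : ∀ v w, b v w = b w v)
    (hR : ∀ u v, R u v = - R v u) (hskew : ∀ u v w w', b (R u v w) w' = - b w (R u v w'))
    (hcurv : ∀ (n : ℕ) (u v : Fin n → Model m),
      0 ≤ ∑ a, ∑ c, b (R (u a) (v a) (v c)) (u c))
    (α : Form m p) : formInnerB b (weitzenbock b R p α) α ≤ 0 := by
  cases p with
  | zero => simp [weitzenbock]
  | succ p =>
  set s : ι → ι → Form m (p + 1) := fun a c => formAction (skewOp b (e a) (e c)) α with hs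
  set X : ℝ := ∑ c, ∑ a, formInnerB b ((formAction (R (e c) (e a)) α).curryLeft (e a))
    (α.curryLeft (e c)) with hX
  have h1 : formInnerB b (weitzenbock b R (p + 1) α) α = - X := by
    rw [he.weitzenbock_succ, map_neg, LinearMap.neg_apply, map_sum, LinearMap.sum_apply, hX,
      Finset.sum_comm]
    congr 1
    refine Finset.sum_congr rfl fun a _ => ?_
    rw [curvatureTerm_apply, he.formInnerB_alternatizeUncurryFin]
    rfl
  have h2 : 2 * X = - ∑ c, ∑ a, formInnerB b (formAction (R (e c) (e a)) α) (s c a) := by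
    -- Exchanging the roles of `a` and `c` changes the sign of `R`. Averaging the two expressions
    -- for `X` leaves an antisymmetric combination, to which `formInnerB_skewOp` applies.
    have h3 : X = - ∑ c, ∑ a, formInnerB b ((formAction (R (e c) (e a)) α).curryLeft (e c))
        (α.curryLeft (e a)) := by
      rw [hX, Finset.sum_comm, ← Finset.sum_neg_distrib]
      refine Finset.sum_congr rfl fun a _ => ?_
      rw [← Finset.sum_neg_distrib]
      refine Finset.sum_congr rfl fun c _ => ?_
      rw [hR, ← formActionL_apply, map_neg, neg_apply, ← interiorL_apply, map_neg, map_neg]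
      rfl
    rw [two_mul]
    nth_rw 2 [h3]
    rw [hX, ← sub_eq_add_neg]
    simp only [← Finset.sum_sub_distrib, ← Finset.sum_neg_distrib]
    refine Finset.sum_congr rfl fun c _ => Finset.sum_congr rfl fun a _ => ?_
    rw [← he.formInnerB_skewOp, he.formInnerB_formAction (skewOp_skew hb _ _) hb,
      formAction_neg, map_neg]
  have h4 : ∀ c a, formInnerB b (formAction (R (e c) (e a)) α) (s c a) =
      (1 / 2) * ∑ d, ∑ f, b (R (e c) (e a) (e d)) (e f) * formInnerB b (s d f) (s c a) := by
    intro c a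
    conv_lhs => rw [he.eq_sum_skewOp hb (hskew (e c) (e a)), ← formActionL_apply]
    simp [hs]
  have h5 : 0 ≤ - ∑ c, ∑ a, ∑ d, ∑ f, b (R (e c) (e a) (e d)) (e f) *
      formInnerB b (s d f) (s c a) := by
    -- For scalar coefficients this is the curvature operator evaluated on the bivector `∑ t_{ca}
    -- e_c ∧ e_a`; the pairs `(c, a)` are enumerated to match the indexing in `hcurv`.
    have h6 : ∀ t : ι → ι → ℝ, 0 ≤ ∑ c, ∑ a, ∑ d, ∑ f,
        - (b (R (e c) (e a) (e d)) (e f) * (t d f * t c a)) := by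
      intro t
      let E := Fintype.equivFin (ι × ι)
      have := hcurv _ (fun k => t (E.symm k).1 (E.symm k).2 • e (E.symm k).1)
        (fun k => e (E.symm k).2)
      rw [E.symm.sum_comp (fun x : ι × ι => ∑ k,
        b (R (t x.1 x.2 • e x.1) (e x.2) (e (E.symm k).2))
          (t (E.symm k).1 (E.symm k).2 • e (E.symm k).1)), Fintype.sum_prod_type] at this
      refine this.trans_eq ?_
      refine Finset.sum_congr rfl fun c _ => Finset.sum_congr rfl fun a _ => ?_
      rw [E.symm.sum_comp (fun x : ι × ι =>
        b (R (t c a • e c) (e a) (e x.2)) (t x.1 x.2 • e x.1)), Fintype.sum_prod_type]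
      refine Finset.sum_congr rfl fun d _ => Finset.sum_congr rfl fun f _ => ?_
      simp only [map_smul, FunLike.coe_smul, Pi.smul_apply, smul_eq_mul]
      rw [hskew, hb]
      ring
    -- In frame components the Gram matrix of the `s_{ca}` is a positive multiple of a sum over
    -- multi-indices `I` of products of scalars, so `h6` applies to each `I` separately.
    simp only [he.formInnerB_eq, Finset.mul_sum]
    have h7 := Finset.sum_nonneg fun (I : Fin (p + 1) → ι) (_ : I ∈ Finset.univ) =>
      mul_nonneg (inv_nonneg.2 (Nat.cast_nonneg (α := ℝ) (p + 1).factorial))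
        (h6 fun c a => s c a fun k => e (I k))
    refine h7.trans_eq ?_
    simp only [← Finset.sum_neg_distrib, Finset.mul_sum]
    rw [Finset.sum_comm]
    refine Finset.sum_congr rfl fun c _ => ?_
    rw [Finset.sum_comm]
    refine Finset.sum_congr rfl fun a _ => ?_
    rw [Finset.sum_comm]
    refine Finset.sum_congr rfl fun d _ => ?_
    rw [Finset.sum_comm]
    refine Finset.sum_congr rfl fun f _ => Finset.sum_congr rfl fun I _ => ?_
    ring
  rw [h1]
  simp only [h4, ← Finset.mul_sum] at h2
  linarith

end IsFrame

end Weitzenbock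

/-! ### The algebraic boundary operator: symmetry, uniqueness, sign and boundary identity -/

section BoundaryOperator

variable {m p : ℕ}

/-- The operator `α ↦ ν♭ ∧ (L · ι_ν α - t ι_ν α)`, zero on functions. -/
def boundaryOp (b : Model m →L[ℝ] Model m →L[ℝ] ℝ) (ν : Model m) (t : ℝ)
    (L : Model m →L[ℝ] Model m) : (p : ℕ) → Form m p →ₗ[ℝ] Form m p
  | 0 => 0
  | p + 1 => (ContinuousAlternatingMap.alternatizeUncurryFinCLM ℝ (Model m) ℝ).toLinearMap ∘ₗ
      (ContinuousLinearMap.smulRightL ℝ (Model m) (Form m p) (b ν)).toLinearMap ∘ₗ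
        (((formActionL m p L).toLinearMap - t • LinearMap.id) ∘ₗ (interiorL m p ν).toLinearMap)

theorem boundaryOp_succ (b : Model m →L[ℝ] Model m →L[ℝ] ℝ) (ν : Model m) (t : ℝ)
    (L : Model m →L[ℝ] Model m) (α : Form m (p + 1)) :
    boundaryOp b ν t L (p + 1) α = alternatizeUncurryFin ((b ν).smulRight
      (formAction L (α.curryLeft ν) - t • α.curryLeft ν)) := rfl

theorem boundaryOp_eq_zero (b : Model m →L[ℝ] Model m →L[ℝ] ℝ) (ν : Model m) (t : ℝ)
    (L : Model m →L[ℝ] Model m) (α : Form m (p + 1)) (h : α.curryLeft ν = 0) :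
    boundaryOp b ν t L (p + 1) α = 0 := by
  rw [boundaryOp_succ, h, ← formActionL_apply, map_zero, smul_zero, sub_zero]
  simp [← ContinuousAlternatingMap.alternatizeUncurryFinCLM_apply]

theorem alternatizeUncurryFin_smulRight_eq_zero (φ : Model m →L[ℝ] ℝ) (γ : Form m p)
    (w : Fin (p + 1) → Model m) (hw : ∀ k, φ (w k) = 0) :
    alternatizeUncurryFin (φ.smulRight γ) w = 0 := by
  simp [alternatizeUncurryFin_apply, hw]

/-- The correction term contains `ι_ν ι_ν α = 0`. Consequently `α - φ ∧ ι_ν α` is annihilated by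
`ι_ν`, which gives the splitting used for uniqueness. -/
theorem curryLeft_alternatizeUncurryFin_smulRight (φ : Model m →L[ℝ] ℝ) {ν : Model m}
    (hν : φ ν = 1) (α : Form m (p + 1)) :
    (alternatizeUncurryFin (φ.smulRight (α.curryLeft ν))).curryLeft ν = α.curryLeft ν := by
  cases p with
  | zero => simp [curryLeft_alternatizeUncurryFin_zero, hν]
  | succ p =>
    rw [curryLeft_alternatizeUncurryFin]
    have : interiorL m p ν ∘L φ.smulRight (α.curryLeft ν) = 0 := by
      ext1 w
      simp
    rw [this]
    simp [hν, ← ContinuousAlternatingMap.alternatizeUncurryFinCLM_apply]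

theorem eq_zero_of_curryLeft_eq_zero {ν : Model m} {α : Form m (p + 1)} (h : α.curryLeft ν = 0)
    {v : Fin (p + 1) → Model m} (hv : ∃ k, v k = ν) : α v = 0 := by
  obtain ⟨k, hk⟩ := hv
  have := α.map_insertNth k (v k) (k.removeNth v)
  rw [Fin.insertNth_self_removeNth] at this
  rw [this, hk, ← curryLeft_apply_apply, h]
  simp

/-- The diagonal operator with eigenvalue `0` on `e none` and `c i` on `e (some i)`. -/
def diagOp {κ : Type*} [Fintype κ] (b : Model m →L[ℝ] Model m →L[ℝ] ℝ) (e : Option κ → Model m)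
    (c : κ → ℝ) : Model m →L[ℝ] Model m :=
  ∑ i, c i • (b (e (some i))).smulRight (e (some i))

theorem diagOp_symm {κ : Type*} [Fintype κ] {b : Model m →L[ℝ] Model m →L[ℝ] ℝ}
    {e : Option κ → Model m} (hb : ∀ v w, b v w = b w v) (c : κ → ℝ) (v w : Model m) :
    b (diagOp b e c v) w = b v (diagOp b e c w) := by
  simp only [diagOp, FunLike.coe_sum, Finset.sum_apply, FunLike.coe_smul, Pi.smul_apply, map_sum,
    map_smul, ContinuousLinearMap.smulRight_apply, smul_eq_mul]
  refine Finset.sum_congr rfl fun i _ => ?_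
  rw [hb v]
  ring

namespace IsFrame

variable {κ : Type*} [Fintype κ] [DecidableEq κ] {b : Model m →L[ℝ] Model m →L[ℝ] ℝ}
  {e : Option κ → Model m}

theorem formInnerB_boundaryOp (he : IsFrame b e) (t : ℝ) (L : Model m →L[ℝ] Model m)
    (α β : Form m (p + 1)) :
    formInnerB b (boundaryOp b (e none) t L (p + 1) α) β =
      formInnerB b (formAction L (α.curryLeft (e none)) - t • α.curryLeft (e none))
        (β.curryLeft (e none)) := by
  rw [boundaryOp_succ, he.formInnerB_alternatizeUncurryFin, Finset.sum_eq_single none]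
  · simp [he.ortho]
  · intro a _ ha
    simp [he.ortho, ha.symm]
  · simp

theorem boundaryOp_symm (he : IsFrame b e) (hb : ∀ v w, b v w = b w v) (t : ℝ)
    {L : Model m →L[ℝ] Model m} (hL : ∀ v w, b (L v) w = b v (L w)) (α β : Form m p) :
    formInnerB b (boundaryOp b (e none) t L p α) β =
      formInnerB b α (boundaryOp b (e none) t L p β) := by
  cases p with
  | zero => simp [boundaryOp]
  | succ p =>
    rw [he.formInnerB_boundaryOp, formInnerB_symm hb α, he.formInnerB_boundaryOp, map_sub,
      LinearMap.sub_apply, he.formInnerB_formAction hL hb, formInnerB_symm hb, map_sub,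
      LinearMap.sub_apply, map_smul, map_smul, LinearMap.smul_apply, LinearMap.smul_apply,
      formInnerB_symm hb (α.curryLeft _) (β.curryLeft _)]

/-- A symmetric operator that vanishes on the forms with `ι_ν α = 0` is determined by its
quadratic form on the forms whose restriction to the orthogonal complement of `ν` vanishes. -/
theorem boundaryOperator_unique (he : IsFrame b e) (hb : ∀ v w, b v w = b w v)
    {D : Form m (p + 1) →ₗ[ℝ] Form m (p + 1)}
    (hsymm : ∀ α β, formInnerB b (D α) β = formInnerB b α (D β))
    (hzero : ∀ α : Form m (p + 1), α.curryLeft (e none) = 0 → D α = 0)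
    (hquad : ∀ α : Form m (p + 1), (∀ w : Fin (p + 1) → Model m, (∀ k, b (e none) (w k) = 0) →
      α w = 0) → formInnerB b (D α) α = 0) : D = 0 := by
  have hν : b (e none) (e none) = 1 := by simp [he.ortho]
  have hq : ∀ α, formInnerB b (D α) α = 0 := by
    intro α
    -- The normal part of `α`: it restricts to zero on the complement of `ν` and differs from `α` by
    -- a form in the kernel of `D`.
    set β := alternatizeUncurryFin ((b (e none)).smulRight (α.curryLeft (e none))) with hβ
    have h1 : D α = D β := by
      rw [← sub_eq_zero, ← map_sub]
      refine hzero _ ?_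
      have := curryLeft_alternatizeUncurryFin_smulRight (b (e none)) hν α
      rw [← interiorL_apply, map_sub, interiorL_apply, interiorL_apply, hβ, this, sub_self]
    rw [h1, hsymm, h1, formInnerB_symm hb]
    exact hquad β fun w hw => alternatizeUncurryFin_smulRight_eq_zero _ _ w hw
  refine LinearMap.ext fun α => he.formInnerB_self_eq_zero ?_
  -- Polarisation in the direction `D α`: by symmetry the two cross terms are both `(D α, D α)`.
  have h := hq (α + D α)
  simp only [map_add, LinearMap.add_apply, hq, zero_add, add_zero] at h
  rw [hsymm (D α)] at h
  linarith

theorem diagOp_apply (he : IsFrame b e) (c : κ → ℝ) (a : Option κ) :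
    diagOp b e c (e a) = (a.elim 0 c) • e a := by
  cases a with
  | none => simp [diagOp, he.ortho]
  | some i => simp [diagOp, he.ortho]

theorem formAction_diagOp (he : IsFrame b e) (c : κ → ℝ) (β : Form m p) (I : Fin p → Option κ) :
    formAction (diagOp b e c) β (fun k => e (I k)) =
      (∑ k, (I k).elim 0 c) * β (fun k => e (I k)) := by
  rw [formAction_apply, Finset.sum_mul]
  refine Finset.sum_congr rfl fun k _ => ?_
  rw [he.diagOp_apply, ContinuousAlternatingMap.map_update_smul, Function.update_eq_self]
  rfl

/-- In frame components the operator on `ι_ν α` is diagonal. A component with a normal index or a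
repeated index vanishes; the remaining ones are indexed by injective `J` and carry the factor `∑ c
(J k) - ∑ c i`. -/
theorem boundaryOp_nonpos (he : IsFrame b e) (c : κ → ℝ)
    (hc : ∀ J : Fin p → κ, Function.Injective J → ∑ k, c (J k) ≤ ∑ i, c i)
    (α : Form m (p + 1)) :
    formInnerB b (boundaryOp b (e none) (∑ i, c i) (diagOp b e c) (p + 1) α) α ≤ 0 := by
  rw [he.formInnerB_boundaryOp, he.formInnerB_eq]
  refine mul_nonpos_of_nonneg_of_nonpos (by positivity) (Finset.sum_nonpos fun I _ => ?_)
  rw [ContinuousAlternatingMap.sub_apply, ContinuousAlternatingMap.smul_apply,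
    he.formAction_diagOp, smul_eq_mul, ← sub_mul, mul_assoc]
  by_cases h0 : (α.curryLeft (e none)) (fun k => e (I k)) = 0
  · simp [h0]
  have hne : ∀ k, I k ≠ none := by
    intro k hk
    refine h0 ?_
    rw [curryLeft_apply_apply]
    exact ContinuousAlternatingMap.map_eq_zero_of_eq _ _ (i := 0) (j := k.succ) (by simp [hk])
      (Fin.succ_ne_zero k).symm
  have hinj : Function.Injective I := by
    intro j k hjk
    by_contra hne
    exact h0 (ContinuousAlternatingMap.map_eq_zero_of_eq _ _ (by rw [hjk]) hne)
  have hJ : ∀ k, ∃ i, I k = some i := fun k => Option.ne_none_iff_exists'.1 (hne k)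
  choose J hJ using hJ
  refine mul_nonpos_of_nonpos_of_nonneg ?_ (mul_self_nonneg _)
  have := hc J fun j k hjk => hinj (by rw [hJ, hJ, hjk])
  simpa [hJ] using this

/-- A form whose restriction to `ν^⊥` vanishes only sees the normal part of one argument. -/
theorem map_update_of_tangential (he : IsFrame b e) {α : Form m p}
    (hα : ∀ w : Fin p → Model m, (∀ k, b (w k) (e none) = 0) → α w = 0)
    {w : Fin p → Model m} (hw : ∀ k, b (w k) (e none) = 0) (k : Fin p) (u : Model m) :
    α (Function.update w k u) = b u (e none) * α (Function.update w k (e none)) := by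
  have h : α (Function.update w k (u - b u (e none) • e none)) = 0 := by
    refine hα _ fun j => ?_
    rcases eq_or_ne j k with rfl | hj
    · simp [he.ortho]
    · simp [hj, hw]
  rw [ContinuousAlternatingMap.map_update_sub, ContinuousAlternatingMap.map_update_smul,
    sub_eq_zero] at h
  exact h

/-- Here `D` plays the role of `∇α` and `Γ i` that of the Christoffel endomorphism along `e_i`. The
terms with `∇_ν α` cancel among the three expressions, and the tangential remainder sees only the
normal components of `Γ i`, which form the diagonal matrix of the `c i`. -/
theorem boundary_identity (he : IsFrame b e) (hb : ∀ v w, b v w = b w v) (c : κ → ℝ)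
    {α : Form m (p + 1)} (D : Model m →L[ℝ] Form m (p + 1)) (Γ : κ → Model m →L[ℝ] Model m)
    (hα : ∀ w : Fin (p + 1) → Model m, (∀ k, b (w k) (e none) = 0) → α w = 0)
    (hD : ∀ (i : κ) (w : Fin (p + 1) → Model m), (∀ k, b (w k) (e none) = 0) →
      D (e (some i)) w = - formAction (Γ i) α w)
    (hΓ : ∀ i j, b (Γ i (e (some j))) (e none) = if i = j then c i else 0) :
    formInnerB b α ((alternatizeUncurryFin D).curryLeft (e none)) -
        formInnerB b (- ∑ a, (D (e a)).curryLeft (e a)) (α.curryLeft (e none)) -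
        formInnerB b (D (e none)) α =
      formInnerB b (boundaryOp b (e none) (∑ i, c i) (diagOp b e c) (p + 1) α) α := by
  have h1 : formInnerB b α ((alternatizeUncurryFin D).curryLeft (e none)) =
      formInnerB b (D (e none)) α -
        ∑ a, formInnerB b ((D (e a)).curryLeft (e none)) (α.curryLeft (e a)) := by
    rw [formInnerB_symm hb]
    rw [curryLeft_alternatizeUncurryFin, map_sub, LinearMap.sub_apply,
      he.formInnerB_alternatizeUncurryFin]
    rfl
  -- On frame vectors, either `ν` appears twice in the first factor or the second factor evaluates
  -- `α` on tangential vectors only.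
  have h2 : ∀ i, formInnerB b ((D (e (some i))).curryLeft (e none)) (α.curryLeft (e (some i)))
      = 0 := by
    intro i
    rw [he.formInnerB_eq, Finset.sum_eq_zero, mul_zero]
    intro I _
    rw [curryLeft_apply_apply, curryLeft_apply_apply]
    by_cases hI : ∃ k, I k = none
    · obtain ⟨k, hk⟩ := hI
      rw [ContinuousAlternatingMap.map_eq_zero_of_eq _ _ (i := 0) (j := k.succ) (by simp [hk])
        (Fin.succ_ne_zero k).symm, zero_mul]
    · push Not at hI
      rw [hα, mul_zero]
      intro k
      cases k using Fin.cases with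
      | zero => simp [he.ortho]
      | succ k => simp [he.ortho, hI]
  have h3 : ∑ i, formInnerB b ((D (e (some i))).curryLeft (e (some i))) (α.curryLeft (e none)) =
      formInnerB b (formAction (diagOp b e c) (α.curryLeft (e none)) -
        (∑ i, c i) • α.curryLeft (e none)) (α.curryLeft (e none)) := by
    simp only [he.formInnerB_eq]
    rw [← Finset.mul_sum, Finset.sum_comm]
    congr 1
    refine Finset.sum_congr rfl fun I _ => ?_
    rw [← Finset.sum_mul]
    by_cases hI : ∃ k, I k = none
    · obtain ⟨k, hk⟩ := hI
      have : (α.curryLeft (e none)) (fun k => e (I k)) = 0 := by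
        rw [curryLeft_apply_apply]
        exact ContinuousAlternatingMap.map_eq_zero_of_eq _ _ (i := 0) (j := k.succ) (by simp [hk])
          (Fin.succ_ne_zero k).symm
      rw [this, mul_zero, mul_zero]
    · push Not at hI
      have hJ : ∀ k, ∃ i, I k = some i := fun k => Option.ne_none_iff_exists'.1 (hI k)
      choose J hJ using hJ
      congr 1
      rw [ContinuousAlternatingMap.sub_apply, ContinuousAlternatingMap.smul_apply,
        he.formAction_diagOp, smul_eq_mul, ← sub_mul]
      simp only [hJ, Option.elim_some]
      set β := (α.curryLeft (e none)) (fun k => e (some (J k))) with hβ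
      -- In each slot only the normal part of `Γ i` survives. The first slot contributes `-c i`;
      -- slot `k` contributes only if `J k = i`, and moving `ν` back to the front by a transposition
      -- turns its sign into `+c i`.
      have key : ∀ i, ((D (e (some i))).curryLeft (e (some i))) (fun k => e (some (J k))) =
          ((∑ k, if i = J k then c i else 0) - c i) * β := by
        intro i
        have hw : ∀ k, b (Matrix.vecCons (e (some i)) (fun k => e (some (J k))) k) (e none)
            = 0 := by
          intro k
          cases k using Fin.cases <;> simp [he.ortho]
        rw [curryLeft_apply_apply, hD i _ hw, formAction_apply, Fin.sum_univ_succ]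
        simp only [Matrix.cons_val_zero, Matrix.cons_val_succ,
          he.map_update_of_tangential hα hw _ (Γ i _), hΓ]
        rw [if_true, sub_mul, neg_add_rev, sub_eq_add_neg, Finset.sum_mul,
          ← Finset.sum_neg_distrib]
        congr 1
        · refine Finset.sum_congr rfl fun k _ => ?_
          split_ifs with hik
          · have hsw := α.map_swap (Matrix.vecCons (e none) (fun k => e (some (J k))))
              (Fin.succ_ne_zero k)
            rw [← mul_neg]
            congr 1
            rw [neg_eq_iff_eq_neg, hβ, curryLeft_apply_apply]
            refine Eq.trans ?_ hsw
            refine congrArg α ?_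
            funext j
            cases j using Fin.cases with
            | zero => simp [hik, Function.update_of_ne (Fin.succ_ne_zero k).symm]
            | succ j =>
              rcases eq_or_ne j k with rfl | hj
              · simp
              · simp [hj, Equiv.swap_apply_of_ne_of_ne]
          · simp
        · congr 2
          rw [hβ, curryLeft_apply_apply]
          congr 1
          funext j
          cases j using Fin.cases <;> simp
      simp only [key]
      rw [← Finset.sum_mul, Finset.sum_sub_distrib, Finset.sum_comm]
      simp
  rw [h1, he.formInnerB_boundaryOp, ← h3, map_neg, LinearMap.neg_apply, map_sum,
    LinearMap.sum_apply, Fintype.sum_option, Fintype.sum_option]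
  simp only [h2, Finset.sum_const_zero]
  ring

end IsFrame

end BoundaryOperator

set_option maxSynthPendingDepth 3

/-! ### One-sided calculus in the half space and the Levi-Civita connection -/

section Calculus

variable {m : ℕ} [NeZero m] {G : Model m → Model m →L[ℝ] Model m →L[ℝ] ℝ} {y : Model m}
  {F F' : Type*} [NormedAddCommGroup F] [NormedSpace ℝ F] [NormedAddCommGroup F']
  [NormedSpace ℝ F']

theorem uniqueDiffWithinAt_halfSpace (hy : y ∈ halfSpace m) :
    UniqueDiffWithinAt ℝ (halfSpace m) y := (𝓡∂ m).uniqueDiffOn y hy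

theorem fderivWithin_clm_comp (hy : y ∈ halfSpace m) (Λ : F →L[ℝ] F') {f : Model m → F}
    (hf : DifferentiableWithinAt ℝ f (halfSpace m) y) (u : Model m) :
    fderivWithin ℝ (fun z => Λ (f z)) (halfSpace m) y u =
      Λ (fderivWithin ℝ f (halfSpace m) y u) := by
  have : HasFDerivWithinAt (fun z => Λ (f z)) _ (halfSpace m) y :=
    Λ.hasFDerivAt.comp_hasFDerivWithinAt y hf.hasFDerivWithinAt
  rw [this.fderivWithin (uniqueDiffWithinAt_halfSpace hy)]
  rfl

theorem fderivWithin_apply_const (hy : y ∈ halfSpace m) {f : Model m → F →L[ℝ] F'}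
    (hf : DifferentiableWithinAt ℝ f (halfSpace m) y) (v : F) (u : Model m) :
    fderivWithin ℝ (fun z => f z v) (halfSpace m) y u =
      fderivWithin ℝ f (halfSpace m) y u v :=
  fderivWithin_clm_comp hy (ContinuousLinearMap.apply ℝ F' v) hf u

theorem _root_.DifferentiableWithinAt.apply_const {m : ℕ} {y : Model m} {f : Model m → F →L[ℝ] F'}
    {s : Set (Model m)}
    (hf : DifferentiableWithinAt ℝ f s y) (v : F) :
    DifferentiableWithinAt ℝ (fun z => f z v) s y :=
  hf.clm_apply (differentiableWithinAt_const v)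

/-- A linear map is the sum of its values on the basis times the coordinate functions, so
differentiability can be checked on basis vectors. -/
theorem differentiableWithinAt_of_apply_stdVec {m : ℕ} {y : Model m}
    {f : Model m → Model m →L[ℝ] F} {s : Set (Model m)}
    (hf : ∀ i, DifferentiableWithinAt ℝ (fun z => f z (stdVec i)) s y) :
    DifferentiableWithinAt ℝ f s y := by
  have h : f = fun z => ∑ i, ContinuousLinearMap.smulRightL ℝ (Model m) F
      (EuclideanSpace.proj i) (f z (stdVec i)) := by
    funext z
    ext1 v
    rw [← ContinuousLinearMap.coe_coe (f z), map_eq_sum_stdVec]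
    simp
  rw [h]
  exact DifferentiableWithinAt.fun_sum fun i _ =>
    (ContinuousLinearMap.differentiableAt _).comp_differentiableWithinAt y (hf i)

/-- `G` is a Riemannian metric of class `C²` near the point `y` of the half space. -/
structure MetricAt (G : Model m → Model m →L[ℝ] Model m →L[ℝ] ℝ) (y : Model m) : Prop where
  mem : y ∈ halfSpace m
  smooth : ContDiffWithinAt ℝ 2 G (halfSpace m) y
  sp : ∀ᶠ z in 𝓝[halfSpace m] y, IsScalarProduct (G z)

theorem _root_.ContDiffWithinAt.eventually_halfSpace {f : Model m → F}
    (hf : ContDiffWithinAt ℝ 2 f (halfSpace m) y) (hy : y ∈ halfSpace m) :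
    ∀ᶠ z in 𝓝[halfSpace m] y, ContDiffWithinAt ℝ 2 f (halfSpace m) z := by
  have := hf.eventually (by simp)
  rwa [insert_eq_of_mem hy] at this

/-- The trace of a function on the two arguments of a scalar product `b`. -/
theorem IsScalarProduct.sum_invGram_apply {m : ℕ} {b : Model m →L[ℝ] Model m →L[ℝ] ℝ}
    (hb : IsScalarProduct b) (φ : Model m →ₗ[ℝ] F) (u : Model m) :
    ∑ i, ∑ j, (invGram b i j * b u (stdVec i)) • φ (stdVec j) = φ u := by
  obtain ⟨e, he⟩ := hb.exists_frame
  have := he.sum_invGram (LinearMap.mk₂ ℝ (fun v w => b u v • φ w) (by simp [add_smul])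
    (by simp [smul_smul]) (by simp) (fun c v w => by rw [map_smul, smul_comm]))
  simp only [LinearMap.mk₂_apply] at this
  rw [he.map_expand φ, ← this]
  simp [smul_smul]

theorem stdVec_apply {m : ℕ} (i j : Fin m) : (stdVec i : Model m) j = if j = i then 1 else 0 := by
  simp [stdVec]

theorem differentiableWithinAt_prod {m : ℕ} {ι : Type*} (t : Finset ι) {f : ι → Model m → ℝ}
    {s : Set (Model m)} {y : Model m} (hf : ∀ i, DifferentiableWithinAt ℝ (f i) s y) :
    DifferentiableWithinAt ℝ (fun z => ∏ i ∈ t, f i z) s y := by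
  classical
  induction t using Finset.induction_on with
  | empty => simp only [Finset.prod_empty]; exact differentiableWithinAt_const _
  | insert a t ha ih =>
    simp only [Finset.prod_insert ha]
    exact (hf a).mul ih

theorem differentiableWithinAt_det {m : ℕ} {y : Model m}
    {A : Model m → Matrix (Fin m) (Fin m) ℝ} {s : Set (Model m)}
    (hA : ∀ i j, DifferentiableWithinAt ℝ (fun z => A z i j) s y) :
    DifferentiableWithinAt ℝ (fun z => (A z).det) s y := by
  simp only [Matrix.det_apply']
  exact DifferentiableWithinAt.fun_sum fun σ _ =>
    (differentiableWithinAt_prod _ fun i => hA _ _).const_mul _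

theorem IsScalarProduct.gram_mul_invGram
    {m : ℕ} {b : Model m →L[ℝ] Model m →L[ℝ] ℝ} (hb : IsScalarProduct b) :
    (Matrix.of fun k l : Fin m => b (stdVec k) (stdVec l)) * (Matrix.of fun i j => invGram b i j)
      = 1 := by
  ext k l
  have h := hb.sum_invGram_apply (EuclideanSpace.proj l : Model m →L[ℝ] ℝ).toLinearMap (stdVec k)
  simp only [ContinuousLinearMap.coe_coe, PiLp.proj_apply, stdVec_apply, smul_eq_mul, mul_ite,
    mul_one, mul_zero, Finset.sum_ite_eq, Finset.mem_univ, if_true] at h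
  simp only [Matrix.mul_apply, Matrix.of_apply, Matrix.one_apply, eq_comm (a := k), ← h]
  exact Finset.sum_congr rfl fun i _ => mul_comm _ _

namespace MetricAt

theorem isScalarProduct (h : MetricAt G y) : IsScalarProduct (G y) := h.sp.self_of_nhdsWithin h.mem

theorem symm (h : MetricAt G y) (v w : Model m) : G y v w = G y w v := h.isScalarProduct.symm v w

/-- The conditions propagate to nearby points of the half space, so pointwise identities of the
connection may be differentiated once more. -/
theorem eventually (h : MetricAt G y) : ∀ᶠ z in 𝓝[halfSpace m] y, MetricAt G z := by
  filter_upwards [h.smooth.eventually_halfSpace h.mem, eventually_eventually_nhdsWithin.2 h.sp,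
    self_mem_nhdsWithin] with z h1 h2 h3
  exact ⟨h3, h1, h2⟩

theorem uniqueDiff (h : MetricAt G y) : UniqueDiffWithinAt ℝ (halfSpace m) y :=
  uniqueDiffWithinAt_halfSpace h.mem

theorem differentiable (h : MetricAt G y) : DifferentiableWithinAt ℝ G (halfSpace m) y :=
  h.smooth.differentiableWithinAt (by simp)

theorem differentiable_fderiv (h : MetricAt G y) :
    DifferentiableWithinAt ℝ (fderivWithin ℝ G (halfSpace m)) (halfSpace m) y :=
  (h.smooth.fderivWithin_right (𝓡∂ m).uniqueDiffOn (m := 1)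
    (by norm_num) h.mem).differentiableWithinAt
    (by simp)

theorem fderiv_apply (h : MetricAt G y) (u v w : Model m) :
    fderivWithin ℝ (fun z => G z v w) (halfSpace m) y u =
      fderivWithin ℝ G (halfSpace m) y u v w := by
  rw [fderivWithin_apply_const h.mem (h.differentiable.apply_const v),
    fderivWithin_apply_const h.mem h.differentiable]

theorem fderiv_symm (h : MetricAt G y) (u v w : Model m) :
    fderivWithin ℝ G (halfSpace m) y u v w = fderivWithin ℝ G (halfSpace m) y u w v := by
  rw [← h.fderiv_apply, ← h.fderiv_apply]
  have : (fun z => G z v w) =ᶠ[𝓝[halfSpace m] y] fun z => G z w v := by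
    filter_upwards [h.sp] with z hz using hz.symm v w
  rw [this.fderivWithin_eq (h.symm v w)]

end MetricAt

theorem christoffel_apply (G : Model m → Model m →L[ℝ] Model m →L[ℝ] ℝ) (y v w : Model m) :
    christoffel G y v w = ∑ k, ∑ l, ((1 / 2 : ℝ) * invGram (G y) k l *
      (fderivWithin ℝ G (halfSpace m) y v w (stdVec l)
        + fderivWithin ℝ G (halfSpace m) y w v (stdVec l)
        - fderivWithin ℝ G (halfSpace m) y (stdVec l) v w)) • stdVec k := by
  simp [christoffel, smul_smul]

/-- The Christoffel symbols as a continuous bilinear map. -/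
def christoffelL (G : Model m → Model m →L[ℝ] Model m →L[ℝ] ℝ) (y : Model m) :
    Model m →L[ℝ] Model m →L[ℝ] Model m :=
  LinearMap.toContinuousLinearMap
    { toFun := christoffel G y
      map_add' := fun v v' => by ext1 w; exact christoffel_add_left G y v v' w
      map_smul' := fun c v => by ext1 w; exact christoffel_smul_left G y c v w }

@[simp]
theorem christoffelL_apply (G : Model m → Model m →L[ℝ] Model m →L[ℝ] ℝ) (y v : Model m) :
    christoffelL G y v = christoffel G y v := rfl

namespace MetricAt

theorem christoffel_symm (h : MetricAt G y) (v w : Model m) :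
    christoffel G y v w = christoffel G y w v := by
  rw [christoffel_apply, christoffel_apply]
  refine Finset.sum_congr rfl fun k _ => Finset.sum_congr rfl fun l _ => ?_
  rw [h.fderiv_symm (stdVec l) v w]
  congr 2
  ring

/-- The Koszul formula: pairing with the metric cancels the inverse Gram matrix in the Christoffel
symbols. -/
theorem christoffel_lower (h : MetricAt G y) (u v w : Model m) :
    G y (christoffel G y u v) w = (1 / 2 : ℝ) * (fderivWithin ℝ G (halfSpace m) y u v w
      + fderivWithin ℝ G (halfSpace m) y v u w - fderivWithin ℝ G (halfSpace m) y w u v) := by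
  set φ : Model m →ₗ[ℝ] ℝ := (1 / 2 : ℝ) • ((fderivWithin ℝ G (halfSpace m) y u v).toLinearMap
      + (fderivWithin ℝ G (halfSpace m) y v u).toLinearMap
      - (((fderivWithin ℝ G (halfSpace m) y).flip u).flip v).toLinearMap) with hφ
  have h1 : ∀ w, φ w = (1 / 2 : ℝ) * (fderivWithin ℝ G (halfSpace m) y u v w
      + fderivWithin ℝ G (halfSpace m) y v u w - fderivWithin ℝ G (halfSpace m) y w u v) :=
    fun w => rfl
  rw [← h1, ← h.isScalarProduct.sum_invGram_apply φ w, christoffel_apply]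
  simp only [map_sum, map_smul, FunLike.coe_sum, Finset.sum_apply, FunLike.coe_smul,
    Pi.smul_apply, smul_eq_mul, h1]
  refine Finset.sum_congr rfl fun k _ => Finset.sum_congr rfl fun l _ => ?_
  rw [h.symm w]
  ring

/-- The Levi-Civita connection is compatible with the metric. -/
theorem fderiv_eq (h : MetricAt G y) (u v w : Model m) :
    fderivWithin ℝ G (halfSpace m) y u v w =
      G y (christoffel G y u v) w + G y v (christoffel G y u w) := by
  rw [h.symm v, h.christoffel_lower, h.christoffel_lower, h.fderiv_symm u w v,
    h.fderiv_symm v u w, h.fderiv_symm w u v]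
  ring

/-- By Cramer's rule the entries are quotients of determinants built from the Gram matrix and
constants, with non-zero denominator. -/
theorem differentiable_invGram (h : MetricAt G y) (i j : Fin m) :
    DifferentiableWithinAt ℝ (fun z => invGram (G z) i j) (halfSpace m) y := by
  have hG : ∀ i j, DifferentiableWithinAt ℝ (fun z => G z (stdVec i) (stdVec j))
      (halfSpace m) y := fun i j => (h.differentiable.apply_const _).apply_const _
  have hdet : (Matrix.of fun k l : Fin m => G y (stdVec k) (stdVec l)).det ≠ 0 :=
    Matrix.det_ne_zero_of_right_inverse h.isScalarProduct.gram_mul_invGram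
  simp only [invGram, Matrix.inv_def, Ring.inverse_eq_inv', Matrix.smul_apply, smul_eq_mul]
  refine ((differentiableWithinAt_det hG).inv hdet).mul ?_
  simp only [Matrix.adjugate_apply]
  refine differentiableWithinAt_det fun k l => ?_
  simp only [Matrix.updateRow_apply]
  split_ifs
  · exact differentiableWithinAt_const _
  · exact hG k l

end MetricAt

end Calculus

/-! ### Parallel contractions and the covariant derivative of forms -/

section Connection

variable {m p : ℕ} [NeZero m] {G : Model m → Model m →L[ℝ] Model m →L[ℝ] ℝ} {y : Model m}
  {F : Type*} [NormedAddCommGroup F] [NormedSpace ℝ F]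

theorem IsScalarProduct.sum_apply_mul_invGram {m : ℕ} {b : Model m →L[ℝ] Model m →L[ℝ] ℝ}
    (hb : IsScalarProduct b) (u : Model m) (l : Fin m) :
    ∑ i, b u (stdVec i) * invGram b i l = u l := by
  have h := hb.sum_invGram_apply (EuclideanSpace.proj l : Model m →L[ℝ] ℝ).toLinearMap u
  simp only [ContinuousLinearMap.coe_coe, PiLp.proj_apply, stdVec_apply, smul_eq_mul, mul_ite,
    mul_one, mul_zero, Finset.sum_ite_eq, Finset.mem_univ, if_true] at h
  rw [← h]
  exact Finset.sum_congr rfl fun i _ => mul_comm _ _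

namespace MetricAt

/-- The inverse metric is parallel. Differentiate `G G⁻¹ = 1`, multiply by `G⁻¹` from the left, and
replace the derivative of `G` by Christoffel symbols using metric compatibility. -/
theorem fderiv_invGram (h : MetricAt G y) (u : Model m) (i l : Fin m) :
    fderivWithin ℝ (fun z => invGram (G z) i l) (halfSpace m) y u =
      - (∑ j, invGram (G y) i j * christoffel G y u (stdVec j) l +
        ∑ j, christoffel G y u (stdVec j) i * invGram (G y) j l) := by
  have hb := h.isScalarProduct
  have h1 : ∀ j, ∑ k, (fderivWithin ℝ G (halfSpace m) y u (stdVec j) (stdVec k) *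
      invGram (G y) k l + G y (stdVec j) (stdVec k) *
        fderivWithin ℝ (fun z => invGram (G z) k l) (halfSpace m) y u) = 0 := by
    intro j
    have hd : ∀ k, HasFDerivWithinAt (fun z => G z (stdVec j) (stdVec k) * invGram (G z) k l)
        _ (halfSpace m) y := fun k =>
      ((h.differentiable.apply_const (stdVec j)).apply_const (stdVec k)).hasFDerivWithinAt.mul
        (h.differentiable_invGram k l).hasFDerivWithinAt
    have hs := (HasFDerivWithinAt.fun_sum fun k (_ : k ∈ Finset.univ) => hd k).fderivWithin
      h.uniqueDiff
    have hc : (fun z => ∑ k, G z (stdVec j) (stdVec k) * invGram (G z) k l)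
        =ᶠ[𝓝[halfSpace m] y] fun _ => (1 : Matrix (Fin m) (Fin m) ℝ) j l := by
      filter_upwards [h.sp] with z hz
      rw [← hz.gram_mul_invGram, Matrix.mul_apply]
      rfl
    rw [hc.fderivWithin_eq_of_mem h.mem] at hs
    have := DFunLike.congr_fun hs u
    simp only [fderivWithin_fun_const, Pi.zero_apply, FunLike.coe_sum, Finset.sum_apply,
      FunLike.coe_add, Pi.add_apply, FunLike.coe_smul, Pi.smul_apply, smul_eq_mul,
      h.fderiv_apply] at this
    rw [show (0 : Model m →L[ℝ] ℝ) u = 0 from rfl] at this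
    rw [this]
    exact Finset.sum_congr rfl fun k _ => by ring
  have h2 : ∑ j, invGram (G y) i j * ∑ k, G y (stdVec j) (stdVec k) *
      fderivWithin ℝ (fun z => invGram (G z) k l) (halfSpace m) y u =
      fderivWithin ℝ (fun z => invGram (G z) i l) (halfSpace m) y u := by
    simp only [Finset.mul_sum]
    rw [Finset.sum_comm]
    have : ∀ k, ∑ j, invGram (G y) i j * (G y (stdVec j) (stdVec k) *
        fderivWithin ℝ (fun z => invGram (G z) k l) (halfSpace m) y u) =
        (if i = k then 1 else 0) *
          fderivWithin ℝ (fun z => invGram (G z) k l) (halfSpace m) y u := by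
      intro k
      rw [← stdVec_apply, ← hb.sum_apply_mul_invGram (stdVec k) i, Finset.sum_mul]
      refine Finset.sum_congr rfl fun j _ => ?_
      rw [invGram_symm hb.symm i j, hb.symm (stdVec j)]
      ring
    simp [this]
  have h3 : ∑ j, invGram (G y) i j * ∑ k, G y (christoffel G y u (stdVec j)) (stdVec k) *
      invGram (G y) k l = ∑ j, invGram (G y) i j * christoffel G y u (stdVec j) l := by
    simp only [hb.sum_apply_mul_invGram]
  have h4 : ∑ j, invGram (G y) i j * ∑ k, G y (stdVec j) (christoffel G y u (stdVec k)) *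
      invGram (G y) k l = ∑ j, christoffel G y u (stdVec j) i * invGram (G y) j l := by
    simp only [Finset.mul_sum]
    rw [Finset.sum_comm]
    refine Finset.sum_congr rfl fun k _ => ?_
    rw [← hb.sum_apply_mul_invGram _ i, Finset.sum_mul]
    refine Finset.sum_congr rfl fun j _ => ?_
    rw [invGram_symm hb.symm i j, hb.symm (stdVec j)]
    ring
  rw [← h2, ← h3, ← h4, ← Finset.sum_add_distrib, ← Finset.sum_neg_distrib]
  refine Finset.sum_congr rfl fun j _ => ?_
  have := h1 j
  simp only [h.fderiv_eq, add_mul, Finset.sum_add_distrib] at this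
  rw [← mul_add, ← mul_neg]
  congr 1
  linarith

/-- Contractions with the metric are parallel. -/
theorem contraction (h : MetricAt G y) {T : Model m → Model m →ₗ[ℝ] Model m →ₗ[ℝ] F}
    (hT : ∀ i j, DifferentiableWithinAt ℝ (fun z => T z (stdVec i) (stdVec j)) (halfSpace m) y) :
    DifferentiableWithinAt ℝ
      (fun z => ∑ i, ∑ j, invGram (G z) i j • T z (stdVec i) (stdVec j)) (halfSpace m) y ∧
    ∀ u, fderivWithin ℝ (fun z => ∑ i, ∑ j, invGram (G z) i j • T z (stdVec i) (stdVec j))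
      (halfSpace m) y u = ∑ i, ∑ j, invGram (G y) i j •
        (fderivWithin ℝ (fun z => T z (stdVec i) (stdVec j)) (halfSpace m) y u
          - T y (christoffel G y u (stdVec i)) (stdVec j)
          - T y (stdVec i) (christoffel G y u (stdVec j))) := by
  have hd : ∀ i j, HasFDerivWithinAt
      (fun z => invGram (G z) i j • T z (stdVec i) (stdVec j)) _ (halfSpace m) y := fun i j =>
    (h.differentiable_invGram i j).hasFDerivWithinAt.smul (hT i j).hasFDerivWithinAt
  have hs := HasFDerivWithinAt.fun_sum fun i (_ : i ∈ Finset.univ) =>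
    HasFDerivWithinAt.fun_sum fun j (_ : j ∈ Finset.univ) => hd i j
  refine ⟨hs.differentiableWithinAt, fun u => ?_⟩
  rw [hs.fderivWithin h.uniqueDiff]
  simp only [FunLike.coe_sum, Finset.sum_apply, FunLike.coe_add, Pi.add_apply, FunLike.coe_smul,
    Pi.smul_apply, ContinuousLinearMap.smulRight_apply, h.fderiv_invGram, smul_sub,
    Finset.sum_sub_distrib, Finset.sum_add_distrib, neg_smul, add_smul, Finset.sum_neg_distrib,
    Finset.sum_smul]
  have h1 : ∑ i, ∑ j, ∑ k, (christoffel G y u (stdVec k) i * invGram (G y) k j) •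
      T y (stdVec i) (stdVec j) = ∑ i, ∑ j, invGram (G y) i j •
        T y (christoffel G y u (stdVec i)) (stdVec j) := by
    conv_rhs =>
      enter [2, i, 2, j]
      rw [← LinearMap.flip_apply, map_eq_sum_stdVec, Finset.smul_sum]
    rw [Finset.sum_comm]
    conv_rhs => rw [Finset.sum_comm]
    refine Finset.sum_congr rfl fun j _ => ?_
    rw [Finset.sum_comm]
    refine Finset.sum_congr rfl fun i _ => Finset.sum_congr rfl fun k _ => ?_
    rw [smul_smul, mul_comm, LinearMap.flip_apply]
  have h2 : ∑ i, ∑ j, ∑ k, (invGram (G y) i k * christoffel G y u (stdVec k) j) •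
      T y (stdVec i) (stdVec j) = ∑ i, ∑ j, invGram (G y) i j •
        T y (stdVec i) (christoffel G y u (stdVec j)) := by
    conv_rhs =>
      enter [2, i, 2, j]
      rw [map_eq_sum_stdVec, Finset.smul_sum]
    refine Finset.sum_congr rfl fun i _ => ?_
    rw [Finset.sum_comm]
    refine Finset.sum_congr rfl fun j _ => Finset.sum_congr rfl fun k _ => ?_
    rw [smul_smul]
  rw [h1, h2]
  abel

theorem differentiable_christoffel (h : MetricAt G y) :
    DifferentiableWithinAt ℝ (christoffelL G) (halfSpace m) y := by
  refine differentiableWithinAt_of_apply_stdVec fun i =>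
    differentiableWithinAt_of_apply_stdVec fun j => ?_
  simp only [christoffelL_apply, christoffel_apply]
  refine DifferentiableWithinAt.fun_sum fun k _ => DifferentiableWithinAt.fun_sum fun l _ => ?_
  have hd : ∀ u v w, DifferentiableWithinAt ℝ
      (fun z => fderivWithin ℝ G (halfSpace m) z u v w) (halfSpace m) y := fun u v w =>
    ((h.differentiable_fderiv.apply_const u).apply_const v).apply_const w
  exact (((h.differentiable_invGram k l).const_mul _).mul
    (((hd _ _ _).add (hd _ _ _)).sub (hd _ _ _))).smul_const _

end MetricAt

/-- The Levi-Civita derivative of a form as a continuous linear map. -/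
def covFormL (G : Model m → Model m →L[ℝ] Model m →L[ℝ] ℝ) (α : Model m → Form m p)
    (y : Model m) : Model m →L[ℝ] Form m p :=
  fderivWithin ℝ α (halfSpace m) y - (formActionL m p).flip (α y) ∘L christoffelL G y

@[simp]
theorem covFormL_apply (G : Model m → Model m →L[ℝ] Model m →L[ℝ] ℝ) (α : Model m → Form m p)
    (y v : Model m) : covFormL G α y v = covForm G α y v := rfl

/-- Torsion-freeness: alternation kills the Christoffel term because it is symmetric. -/
theorem MetricAt.extDerivWithin_eq (h : MetricAt G y) (α : Model m → Form m p) :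
    extDerivWithin α (halfSpace m) y = alternatizeUncurryFin (covFormL G α y) := by
  have h1 : alternatizeUncurryFin ((formActionL m p).flip (α y) ∘L christoffelL G y) = 0 :=
    ContinuousAlternatingMap.alternatizeUncurryFin_fderivCompContinuousLinearMap_eq_zero
      (α y) (ContinuousLinearMap.id ℝ (Model m)) h.christoffel_symm
  rw [covFormL, ← ContinuousAlternatingMap.alternatizeUncurryFinCLM_apply, map_sub,
    ContinuousAlternatingMap.alternatizeUncurryFinCLM_apply,
    ContinuousAlternatingMap.alternatizeUncurryFinCLM_apply, h1, sub_zero]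
  rfl

/-- The Levi-Civita derivative is compatible with the scalar product of forms. -/
theorem MetricAt.formInnerB_leibniz (h : MetricAt G y) {α β : Model m → Form m p}
    (hα : DifferentiableWithinAt ℝ α (halfSpace m) y)
    (hβ : DifferentiableWithinAt ℝ β (halfSpace m) y) :
    DifferentiableWithinAt ℝ (fun z => formInnerB (G z) (α z) (β z)) (halfSpace m) y ∧
    ∀ u, fderivWithin ℝ (fun z => formInnerB (G z) (α z) (β z)) (halfSpace m) y u =
      formInnerB (G y) (covForm G α y u) (β y) + formInnerB (G y) (α y) (covForm G β y u) := by
  induction p with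
  | zero =>
    let ev : Form m 0 →L[ℝ] ℝ := ContinuousAlternatingMap.apply ℝ (Model m) ℝ ![]
    have hev : ∀ γ : Form m 0, ev γ = γ ![] := fun γ => rfl
    simp only [formInnerB_zero_form]
    have hd : HasFDerivWithinAt (fun z => ev (α z) * ev (β z)) _ (halfSpace m) y :=
      (ev.hasFDerivAt.comp_hasFDerivWithinAt y hα.hasFDerivWithinAt).mul
        (ev.hasFDerivAt.comp_hasFDerivWithinAt y hβ.hasFDerivWithinAt)
    refine ⟨hd.differentiableWithinAt, fun u => ?_⟩
    have := hd.fderivWithin h.uniqueDiff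
    simp only [hev] at this
    rw [this]
    simp [covForm, formAction_zero_form, hev]
    ring
  | succ p ih =>
    -- For `v` with constant coefficients, `∇_u (ι_v γ)` contains the extra term `ι_{Γ(u, v)} γ`.
    -- These terms cancel the Christoffel terms of the contraction rule in the induction.
    have hι : ∀ {γ : Model m → Form m (p + 1)} (_ : DifferentiableWithinAt ℝ γ (halfSpace m) y)
        (v : Model m), DifferentiableWithinAt ℝ (fun z => (γ z).curryLeft v) (halfSpace m) y ∧
        ∀ u, covForm G (fun z => (γ z).curryLeft v) y u = (covForm G γ y u).curryLeft v +
          (γ y).curryLeft (christoffel G y u v) := by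
      intro γ hγ v
      refine ⟨(interiorL m p v).differentiableAt.comp_differentiableWithinAt y hγ, fun u => ?_⟩
      have := fderivWithin_clm_comp h.mem (interiorL m p v) hγ u
      simp only [interiorL_apply] at this
      rw [covForm, covForm, this, ← interiorL_apply, ← interiorL_apply, ← interiorL_apply, map_sub]
      simp only [interiorL_apply, curryLeft_formAction]
      abel
    have hc := h.contraction (F := ℝ) (T := fun z => (formInnerB (G z)).compl₁₂
      ((α z).curryLeft : Model m →ₗ[ℝ] Form m p) ((β z).curryLeft : Model m →ₗ[ℝ] Form m p))
      (fun i j => (ih (hι hα (stdVec i)).1 (hι hβ (stdVec j)).1).1)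
    simp only [LinearMap.compl₁₂_apply, ContinuousLinearMap.coe_coe, smul_eq_mul] at hc
    simp only [formInnerB_succ]
    refine ⟨hc.1.const_mul _, fun u => ?_⟩
    rw [fderivWithin_const_mul h.uniqueDiff hc.1, FunLike.coe_smul, Pi.smul_apply, hc.2,
      smul_eq_mul, ← mul_add,
      ← Finset.sum_add_distrib]
    congr 1
    refine Finset.sum_congr rfl fun i _ => ?_
    rw [← Finset.sum_add_distrib]
    refine Finset.sum_congr rfl fun j _ => ?_
    rw [(ih (hι hα (stdVec i)).1 (hι hβ (stdVec j)).1).2, (hι hα (stdVec i)).2,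
      (hι hβ (stdVec j)).2, map_add, map_add, LinearMap.add_apply]
    ring

end Connection

/-! ### Curvature symmetries, the Ricci identity and the Weitzenböck formula -/

section Curvature

variable {m p : ℕ} [NeZero m] {G : Model m → Model m →L[ℝ] Model m →L[ℝ] ℝ} {y : Model m}

/-- The curvature tensor as a continuous bilinear map with values in the endomorphisms. -/
def riemannL (G : Model m → Model m →L[ℝ] Model m →L[ℝ] ℝ) (y : Model m) :
    Model m →L[ℝ] Model m →L[ℝ] Model m →L[ℝ] Model m :=
  (LinearMap.mk₂ ℝ (fun u v =>
    fderivWithin ℝ (christoffelL G) (halfSpace m) y u v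
      - fderivWithin ℝ (christoffelL G) (halfSpace m) y v u
      + (christoffelL G y u ∘L christoffelL G y v - christoffelL G y v ∘L christoffelL G y u))
    (fun u u' v => by
      simp only [map_add, add_apply, ContinuousLinearMap.add_comp, ContinuousLinearMap.comp_add]
      abel)
    (fun c u v => by
      simp only [map_smul, FunLike.coe_smul, Pi.smul_apply, ContinuousLinearMap.smul_comp,
        ContinuousLinearMap.comp_smul, smul_add, smul_sub])
    (fun u v v' => by
      simp only [map_add, add_apply, ContinuousLinearMap.add_comp, ContinuousLinearMap.comp_add]
      abel)
    (fun c u v => by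
      simp only [map_smul, FunLike.coe_smul, Pi.smul_apply, ContinuousLinearMap.smul_comp,
        ContinuousLinearMap.comp_smul, smul_add, smul_sub])).toContinuousBilinearMap

theorem riemannL_apply (G : Model m → Model m →L[ℝ] Model m →L[ℝ] ℝ) (y u v : Model m) :
    riemannL G y u v = fderivWithin ℝ (christoffelL G) (halfSpace m) y u v
      - fderivWithin ℝ (christoffelL G) (halfSpace m) y v u
      + (christoffelL G y u ∘L christoffelL G y v - christoffelL G y v ∘L christoffelL G y u) :=
  rfl

theorem riemannL_swap (G : Model m → Model m →L[ℝ] Model m →L[ℝ] ℝ) (y u v : Model m) :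
    riemannL G y u v = - riemannL G y v u := by
  rw [riemannL_apply, riemannL_apply]
  abel

theorem mem_closure_interior_halfSpace (hy : y ∈ halfSpace m) :
    y ∈ closure (interior (halfSpace m)) := (𝓡∂ m).range_subset_closure_interior hy

/-- One-sided second derivatives are symmetric also at boundary points, since these lie in the
closure of the interior of the half space. -/
theorem fderivWithin_fderivWithin_symm {F : Type*} [NormedAddCommGroup F] [NormedSpace ℝ F]
    {f : Model m → F} (hf : ContDiffWithinAt ℝ 2 f (halfSpace m) y) (hy : y ∈ halfSpace m)
    (u v : Model m) :
    fderivWithin ℝ (fderivWithin ℝ f (halfSpace m)) (halfSpace m) y u v =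
      fderivWithin ℝ (fderivWithin ℝ f (halfSpace m)) (halfSpace m) y v u :=
  hf.isSymmSndFDerivWithinAt (by simp) (𝓡∂ m).uniqueDiffOn
    (mem_closure_interior_halfSpace hy) hy u v

namespace MetricAt

theorem riemannL_eq (h : MetricAt G y) (u v w : Model m) :
    riemannL G y u v w = riemann G y u v w := by
  have key : ∀ u v, covVec G (fun z => covVec G (fun _ => w) z v) y u =
      fderivWithin ℝ (christoffelL G) (halfSpace m) y u v w +
        christoffel G y u (christoffel G y v w) := by
    intro u v
    have h1 : (fun z => covVec G (fun _ => w) z v) = fun z => christoffelL G z v w := by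
      funext z
      simp [covVec]
    rw [h1, covVec, fderivWithin_apply_const h.mem (h.differentiable_christoffel.apply_const v),
      fderivWithin_apply_const h.mem h.differentiable_christoffel]
    rfl
  rw [riemann, key, key, riemannL_apply]
  simp only [add_apply, sub_apply, ContinuousLinearMap.comp_apply, christoffelL_apply]
  abel

/-- The second derivatives of the metric commute. Expressing them through the connection by
differentiating metric compatibility leaves exactly the skewness of `R(u, v)`. -/
theorem riemannL_skew (h : MetricAt G y) (u v w w' : Model m) :
    G y (riemannL G y u v w) w' = - G y w (riemannL G y u v w') := by
  set D := fderivWithin ℝ (christoffelL G) (halfSpace m) y with hD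
  have key : ∀ u v, fderivWithin ℝ (fderivWithin ℝ G (halfSpace m)) (halfSpace m) y u v w w' =
      (fderivWithin ℝ G (halfSpace m) y u (christoffel G y v w) w' + G y (D u v w) w') +
      (fderivWithin ℝ G (halfSpace m) y u w (christoffel G y v w') + G y w (D u v w')) := by
    intro u v
    -- Metric compatibility is needed at all nearby points, as the identity is differentiated at
    -- `y`.
    have h1 : (fun z => fderivWithin ℝ G (halfSpace m) z v w w') =ᶠ[𝓝[halfSpace m] y]
        fun z => G z (christoffelL G z v w) w' + G z w (christoffelL G z v w') := by
      filter_upwards [h.eventually] with z hz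
      exact hz.fderiv_eq v w w'
    have hΓ : ∀ x, HasFDerivWithinAt (fun z => christoffelL G z v x)
        (((ContinuousLinearMap.apply ℝ (Model m) x) ∘L
          (ContinuousLinearMap.apply ℝ (Model m →L[ℝ] Model m) v)) ∘L D) (halfSpace m) y :=
      fun x => ((ContinuousLinearMap.apply ℝ (Model m) x) ∘L
          (ContinuousLinearMap.apply ℝ (Model m →L[ℝ] Model m) v)).hasFDerivAt.comp_hasFDerivWithinAt
          y h.differentiable_christoffel.hasFDerivWithinAt
    have hG := h.differentiable.hasFDerivWithinAt
    have h2 := ((hG.clm_apply (hΓ w)).clm_apply (hasFDerivWithinAt_const w' y (halfSpace m))).add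
      ((hG.clm_apply (hasFDerivWithinAt_const w y (halfSpace m))).clm_apply (hΓ w'))
    have h3 := h2.fderivWithin h.uniqueDiff
    rw [← fderivWithin_apply_const h.mem h.differentiable_fderiv,
      ← fderivWithin_apply_const h.mem (h.differentiable_fderiv.apply_const v),
      ← fderivWithin_apply_const h.mem ((h.differentiable_fderiv.apply_const v).apply_const w),
      h1.fderivWithin_eq_of_mem h.mem]
    refine (DFunLike.congr_fun h3 u).trans ?_
    simp
    ring
  have hs := congrArg (fun T : Model m →L[ℝ] Model m →L[ℝ] ℝ => T w w')
    (fderivWithin_fderivWithin_symm h.smooth h.mem u v)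
  simp only [key, h.fderiv_eq] at hs
  rw [riemannL_apply]
  simp only [← hD, add_apply, sub_apply, ContinuousLinearMap.comp_apply, christoffelL_apply,
    map_add, map_sub]
  linarith

end MetricAt

/-- The second covariant derivative of a form as a continuous bilinear map. -/
def hessL (G : Model m → Model m →L[ℝ] Model m →L[ℝ] ℝ) (α : Model m → Form m p) (y : Model m) :
    Model m →L[ℝ] Model m →L[ℝ] Form m p :=
  (LinearMap.mk₂ ℝ (fun u v => fderivWithin ℝ (covFormL G α) (halfSpace m) y u v
      - formActionL m p (christoffelL G y u) (covFormL G α y v)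
      - covFormL G α y (christoffelL G y u v))
    (fun u u' v => by simp only [map_add, add_apply]; abel)
    (fun c u v => by simp only [map_smul, FunLike.coe_smul, Pi.smul_apply, smul_sub])
    (fun u v v' => by simp only [map_add]; abel)
    (fun c u v => by simp only [map_smul, smul_sub])).toContinuousBilinearMap

theorem hessL_apply (G : Model m → Model m →L[ℝ] Model m →L[ℝ] ℝ) (α : Model m → Form m p)
    (y u v : Model m) : hessL G α y u v = fderivWithin ℝ (covFormL G α) (halfSpace m) y u v
      - formAction (christoffelL G y u) (covFormL G α y v)
      - covFormL G α y (christoffelL G y u v) := rfl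

namespace MetricAt

variable {α : Model m → Form m p}

theorem hasFDerivWithinAt_covForm (h : MetricAt G y)
    (hα : ContDiffWithinAt ℝ 2 α (halfSpace m) y) (v : Model m) :
    DifferentiableWithinAt ℝ (fun z => covFormL G α z v) (halfSpace m) y ∧
    ∀ u, fderivWithin ℝ (fun z => covFormL G α z v) (halfSpace m) y u =
      fderivWithin ℝ (fderivWithin ℝ α (halfSpace m)) (halfSpace m) y u v
      - (formAction (christoffel G y v) (fderivWithin ℝ α (halfSpace m) y u) +
        formAction (fderivWithin ℝ (christoffelL G) (halfSpace m) y u v) (α y)) := by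
  have h1 : DifferentiableWithinAt ℝ (fderivWithin ℝ α (halfSpace m)) (halfSpace m) y :=
    (hα.fderivWithin_right (𝓡∂ m).uniqueDiffOn (m := 1) (by norm_num) h.mem).differentiableWithinAt
      (by simp)
  have hα1 : DifferentiableWithinAt ℝ α (halfSpace m) y := hα.differentiableWithinAt (by simp)
  have h2 : HasFDerivWithinAt (fun z => formActionL m p (christoffelL G z v))
      ((formActionL m p ∘L ContinuousLinearMap.apply ℝ (Model m →L[ℝ] Model m) v) ∘L
        fderivWithin ℝ (christoffelL G) (halfSpace m) y) (halfSpace m) y :=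
    (formActionL m p ∘L ContinuousLinearMap.apply ℝ (Model m →L[ℝ] Model m)
      v).hasFDerivAt.comp_hasFDerivWithinAt y h.differentiable_christoffel.hasFDerivWithinAt
  have h3 : HasFDerivWithinAt (fun z => fderivWithin ℝ α (halfSpace m) z v)
      (ContinuousLinearMap.apply ℝ (Form m p) v ∘L
        fderivWithin ℝ (fderivWithin ℝ α (halfSpace m)) (halfSpace m) y) (halfSpace m) y :=
    (ContinuousLinearMap.apply ℝ (Form m p) v).hasFDerivAt.comp_hasFDerivWithinAt y
      h1.hasFDerivWithinAt
  have h4 := h3.sub (h2.clm_apply hα1.hasFDerivWithinAt)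
  refine ⟨h4.differentiableWithinAt, fun u => ?_⟩
  refine (DFunLike.congr_fun (h4.fderivWithin h.uniqueDiff) u).trans ?_
  simp

theorem differentiable_covFormL (h : MetricAt G y)
    (hα : ContDiffWithinAt ℝ 2 α (halfSpace m) y) :
    DifferentiableWithinAt ℝ (covFormL G α) (halfSpace m) y :=
  differentiableWithinAt_of_apply_stdVec fun _ => (h.hasFDerivWithinAt_covForm hα _).1

theorem covForm₂_eq (h : MetricAt G y) (hα : ContDiffWithinAt ℝ 2 α (halfSpace m) y)
    (u v : Model m) : covForm₂ G α y u v = hessL G α y u v := by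
  have := fderivWithin_apply_const h.mem (h.differentiable_covFormL hα) v u
  rw [hessL_apply, ← this]
  rfl

/-- The Ricci identity. -/
theorem hessL_comm (h : MetricAt G y) (hα : ContDiffWithinAt ℝ 2 α (halfSpace m) y)
    (u v : Model m) :
    hessL G α y u v - hessL G α y v u = - formAction (riemannL G y u v) (α y) := by
  have key : ∀ u v, hessL G α y u v =
      fderivWithin ℝ (fderivWithin ℝ α (halfSpace m)) (halfSpace m) y u v
      - (formAction (christoffel G y v) (fderivWithin ℝ α (halfSpace m) y u) +
        formAction (fderivWithin ℝ (christoffelL G) (halfSpace m) y u v) (α y))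
      - (formAction (christoffel G y u) (fderivWithin ℝ α (halfSpace m) y v)
        - formAction (christoffel G y u) (formAction (christoffel G y v) (α y)))
      - covFormL G α y (christoffelL G y u v) := by
    intro u v
    rw [hessL_apply, ← fderivWithin_apply_const h.mem (h.differentiable_covFormL hα),
      (h.hasFDerivWithinAt_covForm hα v).2,
      ← formActionL_apply (christoffelL G y u), covFormL_apply,
      covForm, map_sub]
    rfl
  have hR : formAction (riemannL G y u v) (α y) =
      formAction (fderivWithin ℝ (christoffelL G) (halfSpace m) y u v) (α y) -
      formAction (fderivWithin ℝ (christoffelL G) (halfSpace m) y v u) (α y) +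
      formAction (christoffel G y u ∘L christoffel G y v - christoffel G y v ∘L christoffel G y u)
        (α y) := by
    rw [riemannL_apply, ← formActionL_apply, map_add, map_sub]
    rfl
  have hc := formAction_comm (christoffel G y u) (christoffel G y v) (α y)
  have hs := fderivWithin_fderivWithin_symm hα h.mem u v
  rw [key, key, hR, hs, christoffelL_apply, christoffelL_apply, h.christoffel_symm u v]
  rw [neg_add, ← hc]
  abel

/-- Since the metric is parallel, `∇_u` passes through the contraction; the Christoffel corrections
complete the plain derivative of `∇α` to its second covariant derivative. -/
theorem covForm_codiff (h : MetricAt G y) {α : Model m → Form m (p + 1)}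
    (hα : ContDiffWithinAt ℝ 2 α (halfSpace m) y) (u : Model m) :
    covForm G (codiff G α) y u = - ∑ i, ∑ j, invGram (G y) i j •
      (hessL G α y u (stdVec i)).curryLeft (stdVec j) := by
  have hd : ∀ i j, DifferentiableWithinAt ℝ
      (fun z => (covFormL G α z (stdVec i)).curryLeft (stdVec j)) (halfSpace m) y := fun i j =>
    (interiorL m p (stdVec j)).differentiableAt.comp_differentiableWithinAt y
      (h.hasFDerivWithinAt_covForm hα (stdVec i)).1
  have hc := h.contraction (F := Form m p) (T := fun z => LinearMap.mk₂ ℝ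
    (fun v w => (covFormL G α z v).curryLeft w)
    (fun v v' w => by simp only [map_add]; rfl) (fun c v w => by simp only [map_smul]; rfl)
    (fun v w w' => by simp only [map_add]) (fun c v w => by simp only [map_smul])) hd
  simp only [LinearMap.mk₂_apply] at hc
  have h1 : codiff G α = fun z => - ∑ i, ∑ j, invGram (G z) i j •
      (covFormL G α z (stdVec i)).curryLeft (stdVec j) := rfl
  rw [covForm, h1, fderivWithin_fun_neg, ← formActionL_apply, map_neg, neg_apply, hc.2,
    sub_neg_eq_add]
  swap
  · exact h.uniqueDiff
  simp only [map_sum, map_smul, formActionL_apply]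
  rw [neg_add_eq_sub, ← neg_sub, ← Finset.sum_sub_distrib]
  congr 1
  refine Finset.sum_congr rfl fun i _ => ?_
  rw [← Finset.sum_sub_distrib]
  refine Finset.sum_congr rfl fun j _ => ?_
  rw [← smul_sub]
  congr 1
  have h2 := fderivWithin_clm_comp h.mem (interiorL m p (stdVec j))
    (h.hasFDerivWithinAt_covForm hα (stdVec i)).1 u
  simp only [interiorL_apply] at h2
  rw [h2, fderivWithin_apply_const h.mem (h.differentiable_covFormL hα), hessL_apply]
  rw [← interiorL_apply _ (_ - _), map_sub, map_sub]
  simp only [interiorL_apply, curryLeft_formAction, christoffelL_apply]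
  abel

/-- Covariant differentiation commutes with alternation, by `formAction_alternatizeUncurryFin`. -/
theorem covForm_extDerivWithin (h : MetricAt G y)
    (hα : ContDiffWithinAt ℝ 2 α (halfSpace m) y) (u : Model m) :
    covForm G (extDerivWithin α (halfSpace m)) y u = alternatizeUncurryFin (hessL G α y u) := by
  have h1 : extDerivWithin α (halfSpace m) =ᶠ[𝓝[halfSpace m] y] fun z =>
      ContinuousAlternatingMap.alternatizeUncurryFinCLM ℝ (Model m) ℝ (covFormL G α z) := by
    filter_upwards [h.eventually] with z hz using hz.extDerivWithin_eq α
  rw [covForm, h1.fderivWithin_eq_of_mem h.mem, h.extDerivWithin_eq,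
    fderivWithin_clm_comp h.mem _ (h.differentiable_covFormL hα), formAction_alternatizeUncurryFin,
    ← ContinuousAlternatingMap.alternatizeUncurryFinCLM_apply, ← map_sub]
  rw [ContinuousAlternatingMap.alternatizeUncurryFinCLM_apply]
  congr 1
  ext1 v
  rw [hessL_apply]
  simp only [sub_apply, add_apply, ContinuousLinearMap.comp_apply, formActionL_apply,
    christoffelL_apply]
  abel

theorem connLaplacian_eq (h : MetricAt G y) (hα : ContDiffWithinAt ℝ 2 α (halfSpace m) y) :
    connLaplacian G α y = - ∑ i, ∑ j, invGram (G y) i j •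
      hessL G α y (stdVec i) (stdVec j) := by
  simp only [connLaplacian, h.covForm₂_eq hα]

/-- The Weitzenböck formula. -/
theorem hodgeLaplacian_eq (h : MetricAt G y) (hα : ContDiffWithinAt ℝ 2 α (halfSpace m) y) :
    hodgeLaplacian G α y = connLaplacian G α y - weitzenbock (G y) (riemannL G y) p (α y) := by
  rw [h.connLaplacian_eq hα]
  cases p with
  | zero =>
    rw [hodgeLaplacian, codiff]
    simp only [h.covForm_extDerivWithin hα, curryLeft_alternatizeUncurryFin_zero]
    simp [weitzenbock]
  | succ p =>
    rw [hodgeLaplacian, h.extDerivWithin_eq, codiff]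
    simp only [h.covForm_extDerivWithin hα, curryLeft_alternatizeUncurryFin]
    have h1 : covFormL G (codiff G α) y = - ∑ i, ∑ j, invGram (G y) i j •
        (interiorL m p (stdVec j) ∘L (hessL G α y).flip (stdVec i)) := by
      ext1 u
      rw [covFormL_apply, h.covForm_codiff hα]
      simp
    rw [h1, ← ContinuousAlternatingMap.alternatizeUncurryFinCLM_apply]
    simp only [map_neg, map_sum, map_smul, weitzenbock, LinearMap.neg_apply, LinearMap.sum_apply,
      LinearMap.smul_apply, LinearMap.flip_apply, curvatureTerm_apply,
      ContinuousAlternatingMap.alternatizeUncurryFinCLM_apply, sub_neg_eq_add]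
    rw [← neg_add, ← Finset.sum_add_distrib, neg_eq_iff_eq_neg, neg_add, neg_neg,
      ← Finset.sum_neg_distrib, ← Finset.sum_add_distrib]
    refine Finset.sum_congr rfl fun i _ => ?_
    rw [← Finset.sum_add_distrib, ← Finset.sum_neg_distrib, ← Finset.sum_add_distrib]
    refine Finset.sum_congr rfl fun j _ => ?_
    -- The term of `dδ` and the remaining term of `δd` differ only in the order of the two
    -- derivatives; interchanging them costs the curvature action.
    have h2 : interiorL m p (stdVec j) ∘L (hessL G α y).flip (stdVec i) =
        interiorL m p (stdVec j) ∘L hessL G α y (stdVec i) -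
        interiorL m p (stdVec j) ∘L (formActionL m (p + 1)).flip (α y) ∘L
          (riemannL G y).flip (stdVec i) := by
      ext1 u
      simp only [ContinuousLinearMap.comp_apply, sub_apply, ContinuousLinearMap.flip_apply,
        formActionL_apply]
      rw [← map_sub]
      congr 1
      rw [sub_eq_add_neg, ← h.hessL_comm hα]
      abel
    rw [h2, ← ContinuousAlternatingMap.alternatizeUncurryFinCLM_apply, map_sub, smul_sub, smul_sub]
    simp only [ContinuousAlternatingMap.alternatizeUncurryFinCLM_apply]
    abel

end MetricAt

end Curvature

/-! ### Passage from the manifold to the preferred chart -/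

section Manifold

variable {m : ℕ} [NeZero m] {M : Type*} [TopologicalSpace M]
  [ChartedSpace (EuclideanHalfSpace m) M]

theorem extChartAt_symm_pt (x : M) : (extChartAt (𝓡∂ m) x).symm (pt m x) = x :=
  extChartAt_to_inv x

theorem two_le_infty : (2 : ℕ∞ω) ≤ ∞ :=
  WithTop.coe_le_coe.2 (le_top : (2 : ℕ∞) ≤ ⊤)

theorem pt_mem_halfSpace (x : M) : pt m x ∈ halfSpace m :=
  extChartAt_target_subset_range x (mem_extChartAt_target x)

theorem extChartAt_target_mem (x : M) : (extChartAt (𝓡∂ m) x).target ∈ 𝓝[halfSpace m] (pt m x) :=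
  extChartAt_target_mem_nhdsWithin x

theorem mem_halfSpace {y : Model m} : y ∈ halfSpace m ↔ 0 ≤ y 0 := by
  rw [halfSpace, range_modelWithCornersEuclideanHalfSpace]; rfl

theorem pt_zero_of_mem_boundary {x : M} (hx : x ∈ (𝓡∂ m).boundary M) : pt m x 0 = 0 := by
  have : pt m x ∈ frontier (range (𝓡∂ m)) := hx
  rw [frontier_range_modelWithCornersEuclideanHalfSpace] at this
  exact this.symm

theorem contDiffWithinAt_localForm {p : ℕ} {x : M} {α : ∀ z : M, FormAt m p z}
    (h : SmoothNear x α) :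
    ContDiffWithinAt ℝ 2 (localForm x α) (halfSpace m) (pt m x) := by
  obtain ⟨U, hU, h⟩ := h
  refine ((h _ ⟨mem_of_mem_nhds hU, pt_mem_halfSpace x⟩).mono_of_mem_nhdsWithin ?_).of_le
    two_le_infty
  exact Filter.inter_mem (mem_nhdsWithin_of_mem_nhds hU) self_mem_nhdsWithin

variable [IsManifold (𝓡∂ m) ∞ M]

theorem isManifold_one : IsManifold (𝓡∂ m) 1 M := IsManifold.of_le (n := ∞) (by simp)

theorem chartInvDeriv_pt (x : M) (v : Model m) :
    (show Model m from chartInvDeriv x (pt m x) v) = v := by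
  have := isManifold_one (m := m) (M := M)
  exact DFunLike.congr_fun (mfderivWithin_range_extChartAt_symm (I := 𝓡∂ m) (x := x)) v

theorem localForm_pt {p : ℕ} (x : M) (α : ∀ z : M, FormAt m p z) :
    localForm x α (pt m x) = α x := by
  -- The chart's inverse returns `x` only up to a propositional equality on which the fibre depends;
  -- a variable base point makes the substitution possible.
  have key : ∀ (z : M) (hz : z = x) (A : Model m →L[ℝ] TangentSpace (𝓡∂ m) z)
      (hA : ∀ v, (show Model m from A v) = v), (α z).compContinuousLinearMap A = α x := by
    rintro z rfl A hA
    ext v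
    exact congrArg (α z) (funext fun k => hA (v k))
  exact key _ (extChartAt_symm_pt x) _ (chartInvDeriv_pt x)

theorem localMetric_pt (g : Metric m M) (x : M) : localMetric g x (pt m x) = g.inner x := by
  have key : ∀ (z : M) (hz : z = x) (A : Model m →L[ℝ] TangentSpace (𝓡∂ m) z)
      (hA : ∀ v, (show Model m from A v) = v),
      (A.precomp ℝ).comp ((g.inner z).comp A) =
        (show Model m →L[ℝ] Model m →L[ℝ] ℝ from g.inner x) := by
    rintro z rfl A hA
    ext v w
    change g.inner z (A v) (A w) = g.inner z v w
    rw [show A v = v from hA v, show A w = w from hA w]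
  exact key _ (extChartAt_symm_pt x) _ (chartInvDeriv_pt x)

theorem localMetric_apply (g : Metric m M) (x : M) (y v w : Model m) :
    localMetric g x y v w = g.inner ((extChartAt (𝓡∂ m) x).symm y) (chartInvDeriv x y v)
      (chartInvDeriv x y w) := rfl

theorem isScalarProduct_localMetric (g : Metric m M) (x : M) {y : Model m}
    (hy : y ∈ (extChartAt (𝓡∂ m) x).target) : IsScalarProduct (localMetric g x y) := by
  have := isManifold_one (m := m) (M := M)
  refine ⟨fun v w => g.symm _ _ _, fun v hv => g.pos _ _ fun h0 => hv ?_⟩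
  -- Definiteness survives the pull-back because the differential of the inverse chart is injective.
  obtain ⟨e, he⟩ := isInvertible_mfderivWithin_extChartAt_symm (I := 𝓡∂ m) hy
  have : e v = 0 := (DFunLike.congr_fun he v).trans h0
  exact (map_eq_zero_iff e e.injective).1 this

theorem contDiffWithinAt_localMetric (g : Metric m M) (x : M) :
    ContDiffWithinAt ℝ ∞ (localMetric g x) (halfSpace m) (pt m x) := by
  have := isManifold_one (m := m) (M := M)
  have h := ((contMDiffAt_hom_bundle _).1 (g.contMDiff x)).2
  have hs : ContMDiffWithinAt 𝓘(ℝ, Model m) (𝓡∂ m) ∞ (extChartAt (𝓡∂ m) x).symm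
      (extChartAt (𝓡∂ m) x).target (pt m x) :=
    contMDiffOn_extChartAt_symm (I := 𝓡∂ m) x _ (mem_extChartAt_target x)
  have h' := ContMDiffAt.comp_contMDiffWithinAt_of_eq h hs (extChartAt_symm_pt x)
  -- On the chart target the inverse of the tangent bundle trivialisation is the differential of the
  -- inverse chart, so the coordinate metric is the bundle expression of `g`, which is smooth by
  -- hypothesis.
  have heq : ∀ y ∈ (extChartAt (𝓡∂ m) x).target, localMetric g x y =
      ((fun z => ContinuousLinearMap.inCoordinates (Model m) (fun z : M => TangentSpace (𝓡∂ m) z)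
        (Model m →L[ℝ] ℝ) (fun z : M => TangentSpace (𝓡∂ m) z →L[ℝ] ℝ) x z x z (g.inner z)) ∘
        (extChartAt (𝓡∂ m) x).symm) y := by
    intro y hy
    have hz : (extChartAt (𝓡∂ m) x).symm y ∈ (chartAt (EuclideanHalfSpace m) x).source := by
      simpa using (extChartAt (𝓡∂ m) x).map_target hy
    have hb : (extChartAt (𝓡∂ m) x).symm y ∈
        (trivializationAt (Model m) (TangentSpace (𝓡∂ m)) x).baseSet := hz
    have hD := TangentBundle.symmL_trivializationAt (I := 𝓡∂ m) hz
    rw [(extChartAt (𝓡∂ m) x).right_inv hy] at hD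
    have hD' : ∀ v : Model m, (trivializationAt (Model m) (TangentSpace (𝓡∂ m)) x).symm
        ((extChartAt (𝓡∂ m) x).symm y) v = chartInvDeriv x y v := fun v => by
      rw [← Bundle.Trivialization.symmL_apply (R := ℝ) _ hb]
      exact DFunLike.congr_fun hD v
    ext v w
    rw [Function.comp_apply]
    refine Eq.trans ?_ (inCoordinates_apply_eq₂ (E₃ := Bundle.Trivial M ℝ) (F₃ := ℝ) hb hb
      (by simp)).symm
    rw [hD', hD']
    simp [localMetric_apply]
  exact (h'.contDiffWithinAt.congr heq (heq _ (mem_extChartAt_target x))).mono_of_mem_nhdsWithin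
    (extChartAt_target_mem (m := m) x)

theorem metricAt (g : Metric m M) (x : M) : MetricAt (localMetric g x) (pt m x) where
  mem := pt_mem_halfSpace x
  smooth := (contDiffWithinAt_localMetric g x).of_le two_le_infty
  sp := Filter.mem_of_superset (extChartAt_target_mem (m := m) x) fun _ hy =>
    isScalarProduct_localMetric g x hy

/-- The form which in the preferred chart at `x` has constant coefficients. -/
def constForm {p : ℕ} (x : M) (α₀ : Form m p) (z : M) : FormAt m p z :=
  α₀.compContinuousLinearMap
    (show TangentSpace (𝓡∂ m) z →L[ℝ] Model m from
      mfderiv (𝓡∂ m) 𝓘(ℝ, Model m) (extChartAt (𝓡∂ m) x) z)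

theorem localForm_constForm {p : ℕ} (x : M) (α₀ : Form m p) {y : Model m}
    (hy : y ∈ (extChartAt (𝓡∂ m) x).target) : localForm x (constForm x α₀) y = α₀ := by
  have := isManifold_one (m := m) (M := M)
  ext v
  refine congrArg α₀ (funext fun k => ?_)
  exact DFunLike.congr_fun
    (mfderiv_extChartAt_comp_mfderivWithin_extChartAt_symm (I := 𝓡∂ m) hy) (v k)

theorem constForm_self {p : ℕ} (x : M) (α₀ : FormAt m p x) : constForm x α₀ x = α₀ :=
  (localForm_pt x _).symm.trans (localForm_constForm x α₀ (mem_extChartAt_target x))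

/-- Smoothness is required only near `x`, so the chart-constant extension needs no cut-off. It
realises every prescribed value at `x`, which gives uniqueness of both tensors. -/
theorem smoothNear_constForm {p : ℕ} (x : M) (α₀ : Form m p) : SmoothNear x (constForm x α₀) := by
  obtain ⟨U, hU, h⟩ := mem_nhdsWithin_iff_exists_mem_nhds_inter.1 (extChartAt_target_mem (m := m) x)
  exact ⟨U, hU, contDiffOn_const.congr fun y hy => localForm_constForm x α₀ (h hy)⟩

theorem restrictsToZeroNear_constForm {p : ℕ} (x : M) {α₀ : Form m p}
    (h0 : ∀ v : Fin p → Model m, (∀ k, v k 0 = 0) → α₀ v = 0) :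
    RestrictsToZeroNear x (constForm x α₀) := by
  have := eventually_nhdsWithin_iff.1 (extChartAt_target_mem (m := m) x)
  filter_upwards [this] with y hy hy0 v hv
  rw [localForm_constForm x α₀ (hy (mem_halfSpace.2 hy0.ge))]
  exact h0 v hv

end Manifold

/-! ### The Weitzenböck tensor on the manifold -/

section WeitzenbockTensor

variable {m : ℕ} [NeZero m] {M : Type*} [TopologicalSpace M]
  [ChartedSpace (EuclideanHalfSpace m) M] [IsManifold (𝓡∂ m) ∞ M] (g : Metric m M)

/-- The curvature tensor at `x`, as a trilinear map. -/
def curvatureL (x : M) : Model m →L[ℝ] Model m →L[ℝ] Model m →L[ℝ] Model m :=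
  riemannL (localMetric g x) (pt m x)

theorem curvatureL_apply (x : M) (u v w : Model m) :
    curvatureL g x u v w = riemannAt g x u v w :=
  (metricAt g x).riemannL_eq u v w

theorem curvatureL_swap (x : M) (u v : Model m) : curvatureL g x u v = - curvatureL g x v u :=
  riemannL_swap _ _ u v

/-- The scalar product on `T_x M`, on the model vector space. -/
def innerL (x : M) : Model m →L[ℝ] Model m →L[ℝ] ℝ := g.inner x

theorem localMetric_pt_eq_innerL (x : M) : localMetric g x (pt m x) = innerL g x :=
  localMetric_pt g x

theorem isScalarProduct_innerL (x : M) : IsScalarProduct (innerL g x) :=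
  localMetric_pt_eq_innerL g x ▸ (metricAt g x).isScalarProduct

theorem curvatureL_skew (x : M) (u v w w' : Model m) :
    innerL g x (curvatureL g x u v w) w' = - innerL g x w (curvatureL g x u v w') := by
  rw [← localMetric_pt_eq_innerL]
  exact (metricAt g x).riemannL_skew u v w w'

/-- The Weitzenböck tensor at `x`. -/
def weitzenbockAt (p : ℕ) (x : M) : FormAt m p x →ₗ[ℝ] FormAt m p x :=
  weitzenbock (innerL g x) (curvatureL g x) p

theorem isWeitzenbockTensor_weitzenbockAt (p : ℕ) (x : M) :
    IsWeitzenbockTensor g x (weitzenbockAt g p x) := by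
  intro α hα
  have h := (metricAt g x).hodgeLaplacian_eq (contDiffWithinAt_localForm hα)
  rw [localForm_pt, localMetric_pt_eq_innerL] at h
  exact h

variable {g} in
theorem IsWeitzenbockTensor.eq {p : ℕ} {x : M} {A B : FormAt m p x →ₗ[ℝ] FormAt m p x}
    (hA : IsWeitzenbockTensor g x A) (hB : IsWeitzenbockTensor g x B) : A = B := by
  refine LinearMap.ext fun α => ?_
  have h := (hA _ (smoothNear_constForm x α)).symm.trans (hB _ (smoothNear_constForm x α))
  rw [constForm_self] at h
  exact sub_right_injective h

theorem weitzenbockAt_one (x : M) (α : FormAt m 1 x) (v : Fin 1 → TangentSpace (𝓡∂ m) x) :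
    weitzenbockAt g 1 x α v = - α (fun k => ricciOp g x (v k)) := by
  obtain ⟨e, he⟩ := (isScalarProduct_innerL g x).exists_frame
  refine (he.weitzenbock_one (isScalarProduct_innerL g x).symm (curvatureL_swap g x)
    (curvatureL_skew g x) α v).trans ?_
  refine congrArg (fun w => - α w) (funext fun k => ?_)
  change _ = ∑ i, ∑ j, (invGram (innerL g x) i j * ricciAt g x (v k) (stdVec i)) •
    (stdVec j : Model m)
  exact Finset.sum_congr rfl fun i _ => Finset.sum_congr rfl fun j _ =>
    congrArg (fun t => (invGram (innerL g x) i j * t) • (stdVec j : Model m))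
      (Finset.sum_congr rfl fun l _ =>
        congrArg (fun z : Model m => z l) (curvatureL_apply g x _ _ _))

theorem weitzenbockAt_nonpos {x : M} (h : CurvatureOperatorNonneg g x) {p : ℕ}
    (α : FormAt m p x) : formInnerAt g x (weitzenbockAt g p x α) α ≤ 0 := by
  obtain ⟨e, he⟩ := (isScalarProduct_innerL g x).exists_frame
  refine he.weitzenbock_nonpos (isScalarProduct_innerL g x).symm (curvatureL_swap g x)
    (curvatureL_skew g x) (fun n u v => ?_) α
  simp only [curvatureL_apply]
  exact h n u v

end WeitzenbockTensor

/-! ### The unit normal, adapted frames and the boundary expression -/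

section UnitNormal

variable {m : ℕ} [NeZero m] {G : Model m → Model m →L[ℝ] Model m →L[ℝ] ℝ} {y : Model m}

theorem IsScalarProduct.invGram_self_pos {m : ℕ} {b : Model m →L[ℝ] Model m →L[ℝ] ℝ}
    (hb : IsScalarProduct b) (i : Fin m) : 0 < invGram b i i := by
  obtain ⟨e, he⟩ := hb.exists_frame
  rw [he.invGram_eq]
  refine (Finset.sum_nonneg fun a _ => mul_self_nonneg _).lt_of_ne fun h0 => ?_
  have h1 : ∀ a, e a i = 0 := fun a => mul_self_eq_zero.1
    ((Finset.sum_eq_zero_iff_of_nonneg fun a _ => mul_self_nonneg _).1 h0.symm a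
      (Finset.mem_univ a))
  have h2 := congrArg (fun v : Model m => v i) (he.expand (stdVec i))
  simp [h1, stdVec_apply] at h2

/-- `ν` is the normalised gradient of the coordinate `y 0`, so pairing with it reads off that
coordinate. Hence the vectors orthogonal to `ν` are those tangent to the boundary. -/
theorem apply_unitNormal (hb : IsScalarProduct (G y)) (w : Model m) :
    G y w (unitNormal G y) = (Real.sqrt (invGram (G y) 0 0))⁻¹ * w 0 := by
  rw [← hb.sum_apply_mul_invGram w 0, unitNormal, map_smul, map_sum]
  simp only [map_smul, smul_eq_mul, mul_comm]

theorem unitNormal_zero :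
    unitNormal G y 0 = Real.sqrt (invGram (G y) 0 0) := by
  have h : (∑ k, invGram (G y) k 0 • stdVec k : Model m) 0 = invGram (G y) 0 0 := by
    simp [stdVec_apply]
  rw [unitNormal, PiLp.smul_apply, h, smul_eq_mul, inv_mul_eq_div, Real.div_sqrt]

theorem apply_unitNormal_eq_zero (hb : IsScalarProduct (G y)) {w : Model m} :
    G y w (unitNormal G y) = 0 ↔ w 0 = 0 := by
  rw [apply_unitNormal hb, mul_eq_zero, inv_eq_zero, or_iff_right]
  exact (Real.sqrt_pos.2 (hb.invGram_self_pos 0)).ne'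

theorem apply_unitNormal_self (hb : IsScalarProduct (G y)) :
    G y (unitNormal G y) (unitNormal G y) = 1 := by
  rw [apply_unitNormal hb, unitNormal_zero]
  exact inv_mul_cancel₀ (Real.sqrt_pos.2 (hb.invGram_self_pos 0)).ne'

/-- Subtracting the normal component leaves a tangential vector, which is expanded in `e`. -/
theorem isFrame_option {κ : Type*} [Fintype κ] [DecidableEq κ] (hb : IsScalarProduct (G y))
    {e : κ → Model m} (h0 : ∀ i, e i 0 = 0)
    (ho : ∀ i j, G y (e i) (e j) = if i = j then 1 else 0)
    (hexp : ∀ v : Model m, v 0 = 0 → v = ∑ i, G y v (e i) • e i) :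
    IsFrame (G y) fun a : Option κ => a.elim (unitNormal G y) e where
  ortho a c := by
    rcases a with - | i <;> rcases c with - | j
    · simpa using apply_unitNormal_self hb
    · simpa [hb.symm (unitNormal G y)] using (apply_unitNormal_eq_zero hb).2 (h0 j)
    · simpa using (apply_unitNormal_eq_zero hb).2 (h0 i)
    · simpa using ho i j
  expand v := by
    have h1 := hexp (v - G y v (unitNormal G y) • unitNormal G y) (by
      rw [← apply_unitNormal_eq_zero hb]
      simp [apply_unitNormal_self hb])
    have h2 : ∀ i, G y (unitNormal G y) (e i) = 0 := fun i => by
      rw [hb.symm]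
      exact (apply_unitNormal_eq_zero hb).2 (h0 i)
    rw [Fintype.sum_option]
    simp only [map_sub, map_smul, sub_apply, smul_apply, h2, smul_zero, sub_zero] at h1
    exact sub_eq_iff_eq_add'.1 h1

theorem secondForm_apply (v w : Model m) :
    secondForm G y v w = G y (christoffel G y v w) (unitNormal G y) := by
  simp [secondForm, covVec]

/-- A function which vanishes on the boundary of the half space has zero derivative along it. -/
theorem fderivWithin_eq_zero_of_tangential {F : Type*} [NormedAddCommGroup F] [NormedSpace ℝ F]
    {f : Model m → F} (hy : y 0 = 0) (hf : DifferentiableWithinAt ℝ f (halfSpace m) y)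
    (h0 : ∀ᶠ z in 𝓝 y, z 0 = 0 → f z = 0) {v : Model m} (hv : v 0 = 0) :
    fderivWithin ℝ f (halfSpace m) y v = 0 := by
  -- The straight line through `y` in direction `v` stays in the boundary hyperplane, on which `f`
  -- vanishes near `y`.
  have hl : HasDerivAt (fun t : ℝ => y + t • v) v 0 := by
    simpa using ((hasDerivAt_id (0 : ℝ)).smul_const v).const_add y
  have hz : ∀ t : ℝ, (y + t • v) 0 = 0 := fun t => by simp [hy, hv]
  have hy0 : y + (0 : ℝ) • v = y := by simp
  have hcomp : HasDerivAt (f ∘ fun t : ℝ => y + t • v) (fderivWithin ℝ f (halfSpace m) y v) 0 := by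
    have := HasFDerivWithinAt.comp_hasDerivWithinAt (s := univ) (t := halfSpace m) (0 : ℝ)
      (by rw [hy0]; exact hf.hasFDerivWithinAt) hl.hasDerivWithinAt
      (fun t _ => mem_halfSpace.2 (hz t).ge)
    rwa [hasDerivWithinAt_univ] at this
  have hev : (f ∘ fun t : ℝ => y + t • v) =ᶠ[𝓝 0] fun _ => 0 := by
    have hc : Filter.Tendsto (fun t : ℝ => y + t • v) (𝓝 0) (𝓝 y) := by
      simpa [hy0] using hl.continuousAt.tendsto
    filter_upwards [hc.eventually h0] with t ht using ht (hz t)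
  exact hcomp.unique ((hasDerivAt_const (0 : ℝ) (0 : F)).congr_of_eventuallyEq hev)

theorem IsFrame.codiff_eq {ι : Type*} [Fintype ι] [DecidableEq ι] {e : ι → Model m}
    (he : IsFrame (G y) e) {p : ℕ} (α : Model m → Form m (p + 1)) :
    codiff G α y = - ∑ a, (covFormL G α y (e a)).curryLeft (e a) := by
  refine congrArg Neg.neg (he.sum_invGram (LinearMap.mk₂ ℝ
    (fun u v => (covFormL G α y u).curryLeft v) (fun u u' v => ?_) (fun r u v => ?_)
    (by simp) (by simp)))
  · rw [map_add]
    rfl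
  · rw [map_smul]
    rfl

/-- The boundary expression of a form whose restriction to the boundary is zero, in a frame of
principal directions. -/
theorem MetricAt.boundaryExpr_eq {κ : Type*} [Fintype κ] [DecidableEq κ] (h : MetricAt G y)
    (hy : y 0 = 0) {e : Option κ → Model m} (he : IsFrame (G y) e) (hν : e none = unitNormal G y)
    {c : κ → ℝ} (hc : ∀ i j, secondForm G y (e (some i)) (e (some j)) = if i = j then c i else 0)
    {p : ℕ} {α : Model m → Form m p} (hα : ContDiffWithinAt ℝ 2 α (halfSpace m) y)
    (h0 : ∀ᶠ z in 𝓝 y, z 0 = 0 → ∀ v : Fin p → Model m, (∀ k, v k 0 = 0) → α z v = 0) :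
    boundaryExpr G α y =
      formInnerB (G y) (boundaryOp (G y) (e none) (∑ i, c i) (diagOp (G y) e c) p (α y)) (α y) := by
  have hb := h.isScalarProduct
  have hd : DifferentiableWithinAt ℝ α (halfSpace m) y := hα.differentiableWithinAt (by simp)
  have ht : ∀ w : Model m, G y w (e none) = 0 ↔ w 0 = 0 := fun w => by
    rw [hν, apply_unitNormal_eq_zero hb]
  have hα0 : ∀ w : Fin p → Model m, (∀ k, G y (w k) (e none) = 0) → α y w = 0 :=
    fun w hw => h0.self_of_nhds hy w fun k => (ht _).1 (hw k)
  have hhalf : 1 / 2 * fderivWithin ℝ (fun z => formInner (G z) (α z) (α z)) (halfSpace m) y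
      (unitNormal G y) = formInnerB (G y) (covFormL G α y (e none)) (α y) := by
    have := (h.formInnerB_leibniz hd hd).2 (unitNormal G y)
    simp only [formInnerB_apply] at this
    rw [this, ← formInnerB_apply, ← formInnerB_apply, formInnerB_symm hb.symm (α y), hν,
      covFormL_apply]
    ring
  rw [boundaryExpr, hhalf, h.extDerivWithin_eq, ← formInnerB_apply, ← hν]
  cases p with
  | zero =>
    have : α y = 0 := by
      ext w
      exact hα0 w fun k => k.elim0
    simp [codiffTerm, this]
  | succ p =>
    rw [codiffTerm, ← formInnerB_apply, he.codiff_eq, ← hν]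
    refine he.boundary_identity hb.symm c (covFormL G α y)
      (fun i => christoffel G y (e (some i))) hα0 (fun i w hw => ?_) fun i j => ?_
    · have h1 : fderivWithin ℝ α (halfSpace m) y (e (some i)) w = 0 := by
        have h2 := fderivWithin_clm_comp h.mem
          (ContinuousAlternatingMap.apply ℝ (Model m) ℝ w) hd (e (some i))
        refine h2.symm.trans (fderivWithin_eq_zero_of_tangential hy ?_ ?_ ?_)
        · exact (ContinuousAlternatingMap.apply ℝ (Model m) ℝ w).differentiableAt.comp_differentiableWithinAt
            y hd
        · filter_upwards [h0] with z hz hz0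
          exact hz hz0 w fun k => (ht _).1 (hw k)
        · rw [← ht, he.ortho]
          simp
      rw [covFormL_apply, covForm, ContinuousAlternatingMap.sub_apply, h1, zero_sub]
    · rw [hν, ← secondForm_apply, hc]

end UnitNormal

/-! ### Sums of smallest eigenvalues -/

section Eigenvalues

theorem sum_take_le_sum_of_sublist : ∀ {l l' : List ℝ}, l.Pairwise (· ≤ ·) → l'.Sublist l →
    (l.take l'.length).sum ≤ l'.sum
  | _, [], _, _ => by simp
  | [], _ :: _, _, h => by simp at h
  | a :: l, b :: l', hs, h => by
    have hb : a ≤ b := by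
      rcases List.mem_cons.1 (h.subset List.mem_cons_self) with rfl | hb
      · exact le_rfl
      · exact List.rel_of_pairwise_cons hs hb
    have := sum_take_le_sum_of_sublist hs.of_cons h.tail
    simpa using add_le_add hb this

/-- Among all sub-multisets of a given size, the smallest elements have the least sum: comparison is
entry by entry in the sorted list. -/
theorem sum_take_sort_le {s t : Multiset ℝ} (h : t ≤ s) :
    ((s.sort (· ≤ ·)).take t.card).sum ≤ t.sum := by
  have h1 : (t.toList : Multiset ℝ) ≤ (s.sort (· ≤ ·) : Multiset ℝ) := by
    rwa [Multiset.coe_toList, Multiset.sort_eq]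
  obtain ⟨l, hl, hsub⟩ := Multiset.coe_le.1 h1
  have h2 := sum_take_le_sum_of_sublist (s.pairwise_sort (· ≤ ·)) hsub
  rwa [hl.length_eq, hl.sum_eq, Multiset.length_toList, Multiset.sum_toList] at h2

theorem toMatrix_eq_diagonal {V ι : Type*} [AddCommGroup V] [Module ℝ V] [Fintype ι]
    [DecidableEq ι] (e : Module.Basis ι ℝ V) {c : ι → ℝ} {L : V →ₗ[ℝ] V}
    (h : ∀ i, L (e i) = c i • e i) : LinearMap.toMatrix e e L = Matrix.diagonal c := by
  ext i j
  rw [LinearMap.toMatrix_apply, h, map_smul, Finsupp.smul_apply, Module.Basis.repr_self,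
    Finsupp.single_apply, Matrix.diagonal_apply]
  rcases eq_or_ne i j with rfl | hij
  · simp
  · simp [hij, hij.symm]

theorem trace_eq_sum {V ι : Type*} [AddCommGroup V] [Module ℝ V] [Fintype ι]
    [DecidableEq ι] (e : Module.Basis ι ℝ V) {c : ι → ℝ} {L : V →ₗ[ℝ] V}
    (h : ∀ i, L (e i) = c i • e i) : LinearMap.trace ℝ V L = ∑ i, c i := by
  rw [LinearMap.trace_eq_matrix_trace ℝ e, toMatrix_eq_diagonal e h, Matrix.trace_diagonal]

theorem roots_charpoly_eq {V ι : Type*} [AddCommGroup V] [Module ℝ V] [Fintype ι]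
    [DecidableEq ι] [Module.Finite ℝ V] [Module.Free ℝ V] (e : Module.Basis ι ℝ V) {c : ι → ℝ}
    {L : V →ₗ[ℝ] V} (h : ∀ i, L (e i) = c i • e i) :
    L.charpoly.roots = Finset.univ.val.map c := by
  rw [← LinearMap.charpoly_toMatrix L e, toMatrix_eq_diagonal e h, Matrix.charpoly_diagonal]
  have := Polynomial.roots_multiset_prod_X_sub_C (Finset.univ.val.map c)
  rwa [Multiset.map_map] at this

/-- The difference of the two sums runs over the `n - p` indices outside the image of `J`, so it is
at least the sum of the `n - p` smallest values. -/
theorem sum_comp_le_of_sum_take_nonneg {n p : ℕ} {c : Fin n → ℝ}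
    (h : 0 ≤ (((Finset.univ.val.map c).sort (· ≤ ·)).take (n - p)).sum) {J : Fin p → Fin n}
    (hJ : Function.Injective J) : ∑ k, c (J k) ≤ ∑ i, c i := by
  set T : Finset (Fin n) := (Finset.univ.map ⟨J, hJ⟩)ᶜ with hT
  have hcard : (T.val.map c).card = n - p := by simp [hT, Finset.card_compl]
  have h1 : 0 ≤ ∑ i ∈ T, c i := by
    have := sum_take_sort_le (Multiset.map_le_map (f := c)
      (Finset.val_le_iff.2 (Finset.subset_univ T)))
    rw [hcard] at this
    exact h.trans this
  have h2 := Finset.sum_compl_add_sum (Finset.univ.map ⟨J, hJ⟩) c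
  rw [Finset.sum_map] at h2
  simp only [Function.Embedding.coeFn_mk] at h2
  linarith

theorem sum_comp_le_of_nonneg {κ : Type*} [Fintype κ] {p : ℕ} {c : κ → ℝ} (h : ∀ i, 0 ≤ c i)
    {J : Fin p → κ} (hJ : Function.Injective J) : ∑ k, c (J k) ≤ ∑ i, c i := by
  have := Finset.sum_le_univ_sum_of_nonneg (s := Finset.univ.map ⟨J, hJ⟩) h
  simpa using this

end Eigenvalues

/-! ### The boundary tensor on the manifold -/

section BoundaryTensor

theorem IsFrame.boundaryOperator_ext {m : ℕ} {κ : Type*} [Fintype κ] [DecidableEq κ]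
    {b : Model m →L[ℝ] Model m →L[ℝ] ℝ} {e : Option κ → Model m} (he : IsFrame b e)
    (hb : ∀ v w, b v w = b w v) {p : ℕ} {S T : Form m (p + 1) →ₗ[ℝ] Form m (p + 1)}
    (hS : ∀ α β, formInnerB b (S α) β = formInnerB b α (S β))
    (hT : ∀ α β, formInnerB b (T α) β = formInnerB b α (T β))
    (hS0 : ∀ α : Form m (p + 1), α.curryLeft (e none) = 0 → S α = 0)
    (hT0 : ∀ α : Form m (p + 1), α.curryLeft (e none) = 0 → T α = 0)
    (hquad : ∀ α : Form m (p + 1), (∀ w : Fin (p + 1) → Model m, (∀ k, b (e none) (w k) = 0) →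
      α w = 0) → formInnerB b (S α) α = formInnerB b (T α) α) : S = T := by
  refine sub_eq_zero.1 (he.boundaryOperator_unique hb (fun α β => ?_) (fun α hα => ?_)
    fun α hα => ?_)
  · rw [LinearMap.sub_apply, LinearMap.sub_apply, map_sub, map_sub, LinearMap.sub_apply, hS, hT]
  · rw [LinearMap.sub_apply, hS0 α hα, hT0 α hα, sub_zero]
  · rw [LinearMap.sub_apply, map_sub, LinearMap.sub_apply, hquad α hα, sub_self]

variable {m : ℕ} [NeZero m] {M : Type*} [TopologicalSpace M]
  [ChartedSpace (EuclideanHalfSpace m) M]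

theorem finrank_bdryTangent (x : M) : Module.finrank ℝ (bdryTangent m x) = m - 1 := by
  let φ : Model m →ₗ[ℝ] ℝ := (EuclideanSpace.proj (0 : Fin m) : Model m →L[ℝ] ℝ).toLinearMap
  have h1 : LinearMap.range φ = ⊤ := by
    refine LinearMap.range_eq_top.2 fun t => ⟨t • stdVec 0, ?_⟩
    simp [φ, stdVec_apply]
  have h2 := φ.finrank_range_add_finrank_ker
  rw [h1, finrank_top, Module.finrank_self, finrank_euclideanSpace_fin] at h2
  have h3 : Module.finrank ℝ (bdryTangent m x) = Module.finrank ℝ (LinearMap.ker φ) := rfl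
  omega

variable [IsManifold (𝓡∂ m) ∞ M] (g : Metric m M)

theorem secondFormAt_symm (x : M) (v w : bdryTangent m x) :
    secondFormAt g x v w = secondFormAt g x w v := by
  have : ∀ v w : Model m, secondForm (localMetric g x) (pt m x) v w =
      secondForm (localMetric g x) (pt m x) w v := fun v w => by
    rw [secondForm_apply, secondForm_apply, (metricAt g x).christoffel_symm]
  exact this (v : TangentSpace (𝓡∂ m) x) (w : TangentSpace (𝓡∂ m) x)

theorem bdryMetric_symm (x : M) (v w : bdryTangent m x) :
    bdryMetric g x v w = bdryMetric g x w v :=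
  g.symm x v w

/-- A basis `e` of `T_x ∂M`, completed by the unit normal. -/
def completedBasis (x : M) {κ : Type*} (e : κ → bdryTangent m x) (a : Option κ) : Model m :=
  a.elim (unitNormal (localMetric g x) (pt m x)) fun i => (e i : TangentSpace (𝓡∂ m) x)

theorem isFrame_completedBasis (x : M) {κ : Type*} [Fintype κ] [DecidableEq κ]
    (e : Module.Basis κ ℝ (bdryTangent m x))
    (he : ∀ i j, bdryMetric g x (e i) (e j) = if i = j then 1 else 0) :
    IsFrame (localMetric g x (pt m x)) (completedBasis g x e) := by
  refine isFrame_option (metricAt g x).isScalarProduct (fun i => (e i).2) (fun i j => ?_)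
    fun v hv => ?_
  · rw [localMetric_pt]
    exact he i j
  · have h0 : ∀ (w : bdryTangent m x) (i : κ), bdryMetric g x w (e i) = e.repr w i := fun w i => by
      conv_lhs => rw [← e.sum_repr w]
      rw [map_sum, LinearMap.sum_apply]
      simp only [map_smul, LinearMap.smul_apply, he, smul_eq_mul, mul_ite, mul_one, mul_zero,
        Finset.sum_ite_eq', Finset.mem_univ, if_true]
    have h1 : ∀ w : bdryTangent m x, w = ∑ i, bdryMetric g x w (e i) • e i := fun w => by
      simp only [h0, e.sum_repr]
    have h2 := congrArg (bdryTangent m x).subtype (h1 ⟨v, hv⟩)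
    rw [map_sum] at h2
    rw [localMetric_pt]
    exact h2

/-- An orthonormal basis of `T_x ∂M` of eigenvectors of the second fundamental form. -/
structure IsPrincipalBasis (x : M) {κ : Type*} [Fintype κ] [DecidableEq κ]
    (e : Module.Basis κ ℝ (bdryTangent m x)) (c : κ → ℝ) : Prop where
  ortho : ∀ i j, bdryMetric g x (e i) (e j) = if i = j then 1 else 0
  eigen : ∀ i, shapeOperator g x (e i) = c i • e i

theorem exists_isPrincipalBasis (x : M) :
    ∃ (e : Module.Basis (Fin (Module.finrank ℝ (bdryTangent m x))) ℝ (bdryTangent m x))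
      (c : Fin (Module.finrank ℝ (bdryTangent m x)) → ℝ), IsPrincipalBasis g x e c := by
  obtain ⟨e, c, he, hc⟩ := exists_orthonormal_eigenbasis (bdryMetric g x) (bdryMetric_symm g x)
    (fun v hv => g.pos x v fun h => hv (Subtype.ext h)) (shapeOperator g x) (fun v w => by
      -- Self-adjointness of the shape operator comes from the symmetry of the second fundamental
      -- form, that is, from the connection being torsion-free.
      rw [bdryMetric_shapeOperator, bdryMetric_symm, bdryMetric_shapeOperator, secondFormAt_symm])
  exact ⟨e, c, he, hc⟩

theorem formInnerAt_eq {p : ℕ} (x : M) (α β : FormAt m p x) :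
    formInnerAt g x α β = formInnerB (localMetric g x (pt m x)) α β := by
  rw [localMetric_pt]
  rfl

section PrincipalBasis

variable {g} {x : M} {κ : Type*} [Fintype κ] [DecidableEq κ]
  {e : Module.Basis κ ℝ (bdryTangent m x)} {c : κ → ℝ}

theorem IsPrincipalBasis.secondFormAt_eq (he : IsPrincipalBasis g x e c) (i j : κ) :
    secondFormAt g x (e i) (e j) = if i = j then c i else 0 := by
  rw [← bdryMetric_shapeOperator, he.eigen, map_smul, LinearMap.smul_apply, he.ortho, smul_eq_mul,
    mul_ite, mul_one, mul_zero]

variable (g e c) in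
/-- The boundary tensor at `x`, in terms of a basis of principal directions. -/
def boundaryTensorAt (p : ℕ) : FormAt m p x →ₗ[ℝ] FormAt m p x :=
  boundaryOp (localMetric g x (pt m x)) (normalAt g x) (∑ i, c i)
    (diagOp (localMetric g x (pt m x)) (completedBasis g x e) c) p

theorem IsPrincipalBasis.isBoundaryTensor (he : IsPrincipalBasis g x e c)
    (hx : x ∈ (𝓡∂ m).boundary M) (p : ℕ) : IsBoundaryTensor g x (boundaryTensorAt g e c p) := by
  have h := metricAt g x
  have hf := isFrame_completedBasis g x e he.ortho
  refine ⟨fun α β => ?_, fun α hα => ?_, fun α hα h0 => ?_⟩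
  · rw [formInnerAt_eq, formInnerAt_eq]
    exact hf.boundaryOp_symm h.symm _ (diagOp_symm h.symm c) α β
  · cases p with
    | zero => rfl
    | succ p =>
      refine boundaryOp_eq_zero _ _ _ _ _ ?_
      ext w
      exact hα _ ⟨0, rfl⟩
  · rw [formInnerAt_eq, h.boundaryExpr_eq (pt_zero_of_mem_boundary hx) hf rfl
      he.secondFormAt_eq (contDiffWithinAt_localForm hα) h0, localForm_pt]
    rfl

theorem IsPrincipalBasis.boundaryTensorAt_nonpos (he : IsPrincipalBasis g x e c) {p : ℕ}
    (hc : ∀ J : Fin (p - 1) → κ, Function.Injective J → ∑ k, c (J k) ≤ ∑ i, c i)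
    (α : FormAt m p x) : formInnerAt g x (boundaryTensorAt g e c p α) α ≤ 0 := by
  rw [formInnerAt_eq]
  cases p with
  | zero =>
    change formInnerB (localMetric g x (pt m x)) (0 : Form m 0) (α : Form m 0) ≤ 0
    rw [map_zero]
    rfl
  | succ p => exact (isFrame_completedBasis g x e he.ortho).boundaryOp_nonpos c hc α

end PrincipalBasis

variable {g} in
theorem IsBoundaryTensor.eq {p : ℕ} {x : M} {S T : FormAt m p x →ₗ[ℝ] FormAt m p x}
    (hS : IsBoundaryTensor g x S) (hT : IsBoundaryTensor g x T) : S = T := by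
  obtain ⟨e, c, he⟩ := exists_isPrincipalBasis g x
  have h := metricAt g x
  have hf := isFrame_completedBasis g x e he.ortho
  obtain ⟨hS1, hS2, hS3⟩ := hS
  obtain ⟨hT1, hT2, hT3⟩ := hT
  cases p with
  | zero =>
    -- A `0`-form has no arguments, so it satisfies the vanishing condition vacuously and both
    -- tensors are zero.
    exact LinearMap.ext fun α => (hS2 α fun _ ⟨k, _⟩ => k.elim0).trans
      (hT2 α fun _ ⟨k, _⟩ => k.elim0).symm
  | succ p =>
    simp only [formInnerAt_eq] at hS1 hS3 hT1 hT3
    have hz : ∀ α : Form m (p + 1), α.curryLeft (normalAt g x : Model m) = 0 →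
        ∀ v : Fin (p + 1) → Model m, (∃ k, v k = normalAt g x) → α v = 0 :=
      fun α hα v hv => eq_zero_of_curryLeft_eq_zero hα hv
    refine hf.boundaryOperator_ext h.symm hS1 hT1 (fun α hα => hS2 α (hz α hα))
      (fun α hα => hT2 α (hz α hα)) fun α hα => ?_
    -- Forms vanishing on tangential vectors extend with constant coefficients to forms restricting
    -- to zero on the boundary, so both tensors have the prescribed quadratic form on them.
    have hr := restrictsToZeroNear_constForm x (α₀ := α) fun v hv => hα v fun k => by
      rw [h.symm]
      exact (apply_unitNormal_eq_zero h.isScalarProduct).2 (hv k)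
    have hs := smoothNear_constForm x α
    have := (hS3 _ hs hr).trans (hT3 _ hs hr).symm
    have h1 : constForm x α x = α := constForm_self x α
    exact h1 ▸ this

variable {g} in
theorem existsUnique_isBoundaryTensor {x : M} (hx : x ∈ (𝓡∂ m).boundary M) (p : ℕ) :
    ∃! S : FormAt m p x →ₗ[ℝ] FormAt m p x, IsBoundaryTensor g x S := by
  obtain ⟨e, c, he⟩ := exists_isPrincipalBasis g x
  exact ⟨_, he.isBoundaryTensor hx p, fun S hS => hS.eq (he.isBoundaryTensor hx p)⟩

section Nonpos

variable {g} {x : M}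

theorem IsBoundaryTensor.nonpos_of_sumSmallestEigenvalues {p : ℕ} (hx : x ∈ (𝓡∂ m).boundary M)
    (hp : 1 ≤ p)
    {S : FormAt m p x →ₗ[ℝ] FormAt m p x} (hS : IsBoundaryTensor g x S)
    (h : 0 ≤ sumSmallestEigenvalues g x (m - p)) (α : FormAt m p x) :
    formInnerAt g x (S α) α ≤ 0 := by
  obtain ⟨e, c, he⟩ := exists_isPrincipalBasis g x
  rw [hS.eq (he.isBoundaryTensor hx p)]
  rw [sumSmallestEigenvalues, roots_charpoly_eq e he.eigen] at h
  -- The boundary has dimension `m - 1` and `ι_ν α` has degree `p - 1`, so `m - p` directions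
  -- remain.
  have hk : m - p = Module.finrank ℝ (bdryTangent m x) - (p - 1) := by
    rw [finrank_bdryTangent]
    omega
  rw [hk] at h
  exact he.boundaryTensorAt_nonpos (fun J hJ => sum_comp_le_of_sum_take_nonneg h hJ) α

theorem IsBoundaryTensor.nonpos_of_trace (hx : x ∈ (𝓡∂ m).boundary M)
    {S : FormAt m 1 x →ₗ[ℝ] FormAt m 1 x} (hS : IsBoundaryTensor g x S)
    (h : 0 ≤ LinearMap.trace ℝ _ (shapeOperator g x)) (α : FormAt m 1 x) :
    formInnerAt g x (S α) α ≤ 0 := by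
  obtain ⟨e, c, he⟩ := exists_isPrincipalBasis g x
  rw [hS.eq (he.isBoundaryTensor hx 1)]
  refine he.boundaryTensorAt_nonpos (fun J hJ => ?_) α
  rw [trace_eq_sum e he.eigen] at h
  -- In degree one `ι_ν α` is a function: no eigenvalue is selected, and the condition is the sign
  -- of the whole trace.
  exact (Fin.sum_univ_zero fun k => c (J k)).trans_le h

theorem IsBoundaryTensor.nonpos_of_secondForm {p : ℕ} (hx : x ∈ (𝓡∂ m).boundary M)
    {S : FormAt m p x →ₗ[ℝ] FormAt m p x} (hS : IsBoundaryTensor g x S)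
    (h : ∀ v : bdryTangent m x, 0 ≤ secondFormAt g x v v) (α : FormAt m p x) :
    formInnerAt g x (S α) α ≤ 0 := by
  obtain ⟨e, c, he⟩ := exists_isPrincipalBasis g x
  rw [hS.eq (he.isBoundaryTensor hx p)]
  refine he.boundaryTensorAt_nonpos (fun J hJ => sum_comp_le_of_nonneg (fun i => ?_) hJ) α
  simpa [he.secondFormAt_eq] using h (e i)

end Nonpos

end BoundaryTensor

end BoundaryGeometry

end

theorem mainTheorem12 {m : ℕ} [NeZero m] {M : Type*} [TopologicalSpace M]
    [ChartedSpace (EuclideanHalfSpace m) M] [IsManifold (𝓡∂ m) ∞ M]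
    (g : BoundaryGeometry.Metric m M) :
    (∀ (p : ℕ) (x : M), ∃! A : BoundaryGeometry.FormAt m p x →ₗ[ℝ] BoundaryGeometry.FormAt m p x,
      BoundaryGeometry.IsWeitzenbockTensor g x A) ∧
    (∀ (x : M) (A : BoundaryGeometry.FormAt m 1 x →ₗ[ℝ] BoundaryGeometry.FormAt m 1 x),
      BoundaryGeometry.IsWeitzenbockTensor g x A →
      ∀ (α : BoundaryGeometry.FormAt m 1 x) (v : Fin 1 → TangentSpace (𝓡∂ m) x),
        A α v = - α (fun k => BoundaryGeometry.ricciOp g x (v k))) ∧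
    (∀ x : M, BoundaryGeometry.CurvatureOperatorNonneg g x →
      ∀ (p : ℕ) (A : BoundaryGeometry.FormAt m p x →ₗ[ℝ] BoundaryGeometry.FormAt m p x),
        BoundaryGeometry.IsWeitzenbockTensor g x A →
        ∀ α : BoundaryGeometry.FormAt m p x, BoundaryGeometry.formInnerAt g x (A α) α ≤ 0) ∧
    (∀ x ∈ (𝓡∂ m).boundary M,
      (∀ p : ℕ, ∃! S : BoundaryGeometry.FormAt m p x →ₗ[ℝ] BoundaryGeometry.FormAt m p x,
        BoundaryGeometry.IsBoundaryTensor g x S) ∧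
      (∀ p : ℕ, 1 ≤ p → p ≤ m → 0 ≤ BoundaryGeometry.sumSmallestEigenvalues g x (m - p) →
        ∀ S : BoundaryGeometry.FormAt m p x →ₗ[ℝ] BoundaryGeometry.FormAt m p x,
          BoundaryGeometry.IsBoundaryTensor g x S →
          ∀ α : BoundaryGeometry.FormAt m p x, BoundaryGeometry.formInnerAt g x (S α) α ≤ 0) ∧
      (0 ≤ LinearMap.trace ℝ _ (BoundaryGeometry.shapeOperator g x) →
        ∀ S : BoundaryGeometry.FormAt m 1 x →ₗ[ℝ] BoundaryGeometry.FormAt m 1 x,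
          BoundaryGeometry.IsBoundaryTensor g x S →
          ∀ α : BoundaryGeometry.FormAt m 1 x, BoundaryGeometry.formInnerAt g x (S α) α ≤ 0) ∧
      ((∀ v : BoundaryGeometry.bdryTangent m x, 0 ≤ BoundaryGeometry.secondFormAt g x v v) →
        ∀ (p : ℕ) (S : BoundaryGeometry.FormAt m p x →ₗ[ℝ] BoundaryGeometry.FormAt m p x),
          BoundaryGeometry.IsBoundaryTensor g x S →
          ∀ α : BoundaryGeometry.FormAt m p x,
            BoundaryGeometry.formInnerAt g x (S α) α ≤ 0)) := by
  open BoundaryGeometry in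
  exact ⟨fun p x => ⟨weitzenbockAt g p x, isWeitzenbockTensor_weitzenbockAt g p x,
      fun A hA => hA.eq (isWeitzenbockTensor_weitzenbockAt g p x)⟩,
    fun x A hA α v => by
      rw [hA.eq (isWeitzenbockTensor_weitzenbockAt g 1 x)]
      exact weitzenbockAt_one g x α v,
    fun x hx p A hA α => by
      rw [hA.eq (isWeitzenbockTensor_weitzenbockAt g p x)]
      exact weitzenbockAt_nonpos g hx α,
    fun x hx => ⟨existsUnique_isBoundaryTensor hx,
      fun p hp _ h S hS => hS.nonpos_of_sumSmallestEigenvalues hx hp h,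
      fun h S hS => hS.nonpos_of_trace hx h,
      fun h p S hS => hS.nonpos_of_secondForm hx h⟩⟩
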